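/- **Theorem.** Let $d\in\mathbb{N}$ and let $\varphi$ be a first-order sentence over the signature consisting of one binary relation symbol $E$ (with equality). Then $\varphi$ can be frugally evaluated over the class of finite connected simple graphs of maximum degree at most $d$. Here a *network* is a finite connected simple graph $G=(V,E)$ with $n=|V|$ nodes, whose edges are bidirectional communication links, together with pairwise distinct node identifiers taken from $\{1,\dots,n\}$, a numbering of the ports of each node (one port for each incident link), a *requesting node* $\rho\in V$, and a BFS tree rooted at $\rho$, that is, each $v\neq\rho$ has a neighbour $\mathrm{parent}(v)$ with $\mathrm{dist}_G(\rho,\mathrm{parent}(v))=\mathrm{dist}_G(\rho,v)-1$. Initially each node knows only its own identifier, the identifier of its parent (none for $\rho$), and for each of its ports whether it leads to its parent, to a child, or along a non-tree edge to a node of the same, of smaller, or of larger depth in the BFS tree. A *distributed algorithm* is a deterministic program with computable local transition functions, the same for all nodes and all networks (it may depend on $d$ and $\varphi$, but $n$ is not known to the nodes). The requesting node takes the first step; every other step is the reception by a node of one message through one of its ports. In each step a node changes its state and sends finitely many messages, which are binary strings (coded as natural numbers), through its ports. The system is asynchronous and without failures: messages in transit are delivered one at a time in an arbitrary order. Some states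 are final, and each final state is either accepting or rejecting. The sentence $\varphi$ *can be frugally evaluated* over a class $\mathcal{C}$ of graphs if there are a distributed algorithm and constants $k,K\in\mathbb{N}$ such that on every network with $G\in\mathcal{C}$, for every choice of the requesting node, the identifiers, the ports and the BFS tree, and under every asynchronous schedule that continues as long as there are messages in transit: 1. the requesting node eventually reaches a final state, keeps its verdict from then on, and this state is accepting if and only if $G\models\varphi$; 2. at most $k$ messages are ever sent over each link (in both directions together), and each message has at most $K\lfloor\log_2 n\rfloor$ bits. -/

import Mathlib

open FirstOrder

/-- The state of a port with respect to the BFS tree: `parent` and `child` for tree edges;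
`horizon`, `upward`, `downward` for non-tree edges to a node of the same, smaller, larger depth. -/
inductive PortStatus : Type
  | parent
  | child
  | horizon
  | upward
  | downward

namespace PortStatus

def toFin : PortStatus → Fin 5
  | parent => 0
  | child => 1
  | horizon => 2
  | upward => 3
  | downward => 4

def ofFin : Fin 5 → PortStatus
  | 0 => parent
  | 1 => child
  | 2 => horizon
  | 3 => upward
  | 4 => downward

def equivFin : PortStatus ≃ Fin 5 where
  toFun := toFin
  invFun := ofFin
  left_inv := by intro s; cases s <;> rfl
  right_inv := by decide

instance : Primcodable PortStatus := Primcodable.ofEquiv (Fin 5) equivFin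

end PortStatus

/-- A network: a finite connected graph with unique identifiers taken from `1, …, n`
(`n` the number of nodes), a local numbering of the ports of each node, a requesting node,
and a BFS tree rooted at the requesting node. -/
structure Network (V : Type) [Fintype V] where
  graph : SimpleGraph V
  connected : graph.Connected
  /-- The identifiers. -/
  ident : V → ℕ
  ident_mem : ∀ v, 1 ≤ ident v ∧ ident v ≤ Fintype.card V
  ident_injective : Function.Injective ident
  /-- Port number `i` (from `0`) of `v` is attached to the link from `v` to the `i`-th entry of
  `ports v`. Nodes do not have access to this list. -/
  ports : V → List V
  ports_nodup : ∀ v, (ports v).Nodup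
  mem_ports : ∀ v u, u ∈ ports v ↔ graph.Adj v u
  /-- The requesting node. -/
  root : V
  /-- The parent in the BFS tree; the value at `root` is never used. -/
  parent : V → V
  parent_adj : ∀ v, v ≠ root → graph.Adj v (parent v)
  parent_dist : ∀ v, v ≠ root → graph.dist root v = graph.dist root (parent v) + 1

/-- What a node stores before the computation: its own identifier, the identifier of its parent
in the BFS tree (`none` exactly at the requesting node), and the list of the states of its
ports, in the order of the port numbers. -/
abbrev LocalInput : Type := ℕ × Option ℕ × List PortStatus

namespace Network

variable {V : Type} [Fintype V] [DecidableEq V]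

/-- The state, at `v`, of the port leading to the neighbour `u`. -/
noncomputable def portStatus (N : Network V) (v u : V) : PortStatus :=
  if v ≠ N.root ∧ N.parent v = u then .parent
  else if u ≠ N.root ∧ N.parent u = v then .child
  else if N.graph.dist N.root u = N.graph.dist N.root v then .horizon
  else if N.graph.dist N.root u < N.graph.dist N.root v then .upward
  else .downward

noncomputable def localInput (N : Network V) (v : V) : LocalInput :=
  (N.ident v,
   if v = N.root then none else some (N.ident (N.parent v)),
   (N.ports v).map (N.portStatus v))

end Network

/-- A (deterministic, message-driven) distributed algorithm. All nodes run the same program, which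
knows neither the network nor its number of nodes. Messages are natural numbers, read as binary
strings. An outbox is a list of pairs (port number, message); ports are numbered from `0`.
The local computations are required to be computable. -/
structure DistAlgorithm where
  State : Type
  [primcodable : Primcodable State]
  /-- The state of a node before the computation. -/
  init : LocalInput → State
  /-- The first step, taken by the requesting node only. -/
  start : State → State × List (ℕ × ℕ)
  /-- The step taken in a given state on receipt of a message through a given port. -/
  receive : State → ℕ × ℕ → State × List (ℕ × ℕ)
  /-- `some true`: final and accepting; `some false`: final and rejecting; `none`: not final. -/
  verdict : State → Option Bool
  computable_init : Computable init
  computable_start : Computable start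
  computable_receive : Computable₂ receive
  computable_verdict : Computable verdict

/-- A global configuration. A triple `(u, v, m)` is a message `m` sent by `u` to `v`;
`transit` holds the messages that are still to be delivered, `sent` all messages sent so far. -/
structure Configuration (V S : Type) where
  state : V → S
  transit : Multiset (V × V × ℕ)
  sent : Multiset (V × V × ℕ)

namespace DistAlgorithm

variable {V : Type} [Fintype V] [DecidableEq V]

/-- The messages that `v` sends when it processes `outbox`; entries with a port number that `v`
does not have are void. -/
def emit (N : Network V) (v : V) (outbox : List (ℕ × ℕ)) : Multiset (V × V × ℕ) :=
  (outbox.filterMap fun p => ((N.ports v)[p.1]?).map fun u => (v, u, p.2) : List (V × V × ℕ))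

/-- The configuration after the requesting node has taken its first step. -/
noncomputable def initialConfig (A : DistAlgorithm) (N : Network V) : Configuration V A.State where
  state := Function.update (fun v => A.init (N.localInput v)) N.root
    (A.start (A.init (N.localInput N.root))).1
  transit := emit N N.root (A.start (A.init (N.localInput N.root))).2
  sent := emit N N.root (A.start (A.init (N.localInput N.root))).2

/-- The configuration after delivery of the message `m` from `u` to `v`. -/
def deliver (A : DistAlgorithm) (N : Network V) (c : Configuration V A.State)
    (u v : V) (m : ℕ) : Configuration V A.State where
  state := Function.update c.state v (A.receive (c.state v) ((N.ports v).idxOf u, m)).1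
  transit := c.transit.erase (u, v, m) +
    emit N v (A.receive (c.state v) ((N.ports v).idxOf u, m)).2
  sent := c.sent + emit N v (A.receive (c.state v) ((N.ports v).idxOf u, m)).2

/-- One asynchronous step: an arbitrary message in transit is delivered (links need not be FIFO). -/
def Step (A : DistAlgorithm) (N : Network V) (c c' : Configuration V A.State) : Prop :=
  ∃ u v m, (u, v, m) ∈ c.transit ∧ c' = A.deliver N c u v m

/-- `c` is a maximal run under some asynchronous schedule: messages are delivered as long as there
are messages in transit, and a run without messages in transit is continued constantly. -/
def IsRun (A : DistAlgorithm) (N : Network V) (c : ℕ → Configuration V A.State) : Prop :=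
  c 0 = A.initialConfig N ∧
    ∀ t, A.Step N (c t) (c (t + 1)) ∨ ((c t).transit = 0 ∧ c (t + 1) = c t)

/-- `A` evaluates `φ` over the class `C` of graphs: on every network with graph in `C` and under
every schedule, the requesting node eventually reaches a final state, keeps its verdict from then
on, and the final state is accepting if and only if the graph satisfies `φ`. (No fairness of the
schedule is assumed.) -/
def Evaluates (A : DistAlgorithm) (C : ∀ V : Type, SimpleGraph V → Prop)
    (φ : Language.graph.Sentence) : Prop :=
  ∀ (V : Type) [Fintype V] [DecidableEq V] (N : Network V), C V N.graph →
    ∀ c : ℕ → Configuration V A.State, A.IsRun N c →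
      ∃ (b : Bool) (t : ℕ),
        (∀ t', A.verdict ((c t').state N.root) = if t ≤ t' then some b else none) ∧
        (b = true ↔ @Language.Sentence.Realize Language.graph V N.graph.structure φ)

/-- `A` is frugal over `C`: there are constants `k` and `K` such that on every network with graph
in `C`, and under every schedule, at most `k` messages are ever sent over each link (both
directions together), and each message has at most `K * log₂ n` bits. -/
def IsFrugal (A : DistAlgorithm) (C : ∀ V : Type, SimpleGraph V → Prop) : Prop :=
  ∃ k K : ℕ, ∀ (V : Type) [Fintype V] [DecidableEq V] (N : Network V), C V N.graph →
    ∀ c : ℕ → Configuration V A.State, A.IsRun N c → ∀ t,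
      (∀ u v, N.graph.Adj u v →
        Multiset.card ((c t).sent.filter fun e => s(e.1, e.2.1) = s(u, v)) ≤ k) ∧
      ∀ e ∈ (c t).sent, Nat.size e.2.2 ≤ K * Nat.log 2 (Fintype.card V)

end DistAlgorithm

/-- `φ` can be frugally evaluated over the class `C` of graphs. -/
def FrugallyEvaluable (C : ∀ V : Type, SimpleGraph V → Prop)
    (φ : Language.graph.Sentence) : Prop :=
  ∃ A : DistAlgorithm, A.Evaluates C φ ∧ A.IsFrugal C

/-- The graphs with all degrees finite and at most `d`. -/
def DegreeAtMost (d : ℕ) (V : Type) (G : SimpleGraph V) : Prop :=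
  ∀ v, (G.neighborSet v).encard ≤ d

set_option linter.unusedSectionVars false

/-! In bounded degree, the truth of a first-order sentence depends only on how many nodes have each
local type, counted up to a threshold (Hanf). A type of radius `R` records which port-number walks
of length at most `R` from the node end at the same node. `Network.exists_realize_iff` proves this
by a back-and-forth argument: the radius triples at each quantifier, an element near the tuple is
answered by the same walk, and a far one by a far node of the same type, which exists because the
counts agree up to a threshold exceeding the number of nodes near a tuple.

The counts are found in a bounded number of messages per link. Nodes exchange nested views of radius
`0, …, R`. Since the degree is bounded, a view is a bounded arrangement of identifiers and has O(log
n) bits; since identifiers are distinct, it determines the type. The counts live in a finite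
commutative monoid, so partial sums have bounded size, and they are added up along the BFS tree
(`Network.subtreeSum_root`). The requesting node then applies a fixed Boolean function on this
finite monoid, which is computable however it is defined.

Asynchrony is treated once and for all by `DataflowProgram`. Each payload is a function of the local
input and of named payloads of neighbours, with well-founded dependencies, and is sent once, as soon
as it is computable. The schedule therefore affects only the timing (`Invariant`). Only finitely
many messages are possible, so every run becomes quiet, and in a quiet configuration every payload
has been computed. `DataflowProgram.frugallyEvaluable` packages this, and
`frugallyEvaluable_of_typeSum` applies it to sums of node types. -/

/-! ### Dataflow programs -/

/-- The messages received so far by a node, each stored as `((port, tag), payload)`. -/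
abbrev Record : Type := List ((ℕ × ℕ) × ℕ)

/-- A program by which every node broadcasts one message for each tag `0, …, last`. The payload
for the tag `j` is computed from the local input and from the payloads received for the pairs
(port, tag) listed in `need j`. -/
structure DataflowProgram where
  last : ℕ
  need : ℕ → LocalInput → List (ℕ × ℕ)
  out : ℕ → LocalInput → List ℕ → ℕ
  final : ℕ → Bool
  primrec_need : ∀ j, Primrec (need j)
  primrec_out : ∀ j, Primrec₂ (out j)
  primrec_final : Primrec final

namespace DataflowProgram

/-- A node is awake if it is the requesting node or has received a message. -/
def Awake (l : LocalInput) (h : Record) : Prop := l.2.1 = none ∨ h ≠ []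

instance (l : LocalInput) (h : Record) : Decidable (Awake l h) := by
  unfold Awake; infer_instance

variable (P : DataflowProgram)

/-- The payload for the tag `j` can be computed from the record `h`. -/
def Ready (l : LocalInput) (h : Record) (j : ℕ) : Prop :=
  Awake l h ∧ ∀ k ∈ P.need j l, (h.lookup k).isSome = true

instance (l : LocalInput) (h : Record) (j : ℕ) : Decidable (P.Ready l h j) := by
  unfold Ready; infer_instance

/-- The payload for the tag `j`, if it can be computed. -/
def fire (l : LocalInput) (h : Record) (j : ℕ) : Option ℕ :=
  if P.Ready l h j then some (P.out j l ((P.need j l).filterMap fun k => h.lookup k)) else none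

/-- The messages that can be computed from the record `h`, except for the tags in `old`. -/
def fresh (old : ℕ → Bool) (l : LocalInput) (h : Record) : List ℕ :=
  (List.range (P.last + 1)).filterMap fun j =>
    if old j = true then none else (P.fire l h j).map (Nat.pair j)

/-- The outbox for sending all messages of a list through all ports. -/
def broadcast (deg : ℕ) (ms : List ℕ) : List (ℕ × ℕ) :=
  ms.flatMap fun m => (List.range deg).map fun i => (i, m)

/-- The record after receipt of the message `e.2` through the port `e.1`. -/
def record (h : Record) (e : ℕ × ℕ) : Record := ((e.1, e.2.unpair.1), e.2.unpair.2) :: h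

/-! ### Primitive recursiveness of the local computations -/

/-- Induction on the fixed list `L` is needed because `f b` is primitive recursive for each `b`
separately; programs promise no uniformity in the tag. -/
theorem primrec_filterMap_const {α β σ : Type*} [Primcodable α] [Primcodable σ]
    (L : List β) (f : β → α → Option σ) (hf : ∀ b, Primrec (f b)) :
    Primrec fun a => L.filterMap fun b => f b a := by
  induction L with
  | nil => exact Primrec.const []
  | cons b L ih =>
    have : Primrec fun a => (f b a).toList ++ L.filterMap fun b => f b a :=
      Primrec.list_append.comp (Primrec.optionToList.comp (hf b)) ih
    refine this.of_eq fun a => ?_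
    rw [List.filterMap_cons]
    cases f b a <;> rfl

theorem primrecPred_awake : PrimrecPred fun s : LocalInput × Record => Awake s.1 s.2 := by
  have h1 : Primrec fun s : LocalInput × Record => s.1.2.1 :=
    Primrec.fst.comp (Primrec.snd.comp Primrec.fst)
  have h2 : PrimrecPred fun s : LocalInput × Record => s.1.2.1 = none :=
    PrimrecRel.comp (R := Eq) Primrec.eq h1 (Primrec.const none)
  have h3 : PrimrecPred fun s : LocalInput × Record => s.2 = [] :=
    PrimrecRel.comp (R := Eq) Primrec.eq Primrec.snd (Primrec.const [])
  exact (h2.or h3.not).of_eq fun s => Iff.rfl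

theorem primrec_lookup : Primrec₂ (List.lookup : ℕ × ℕ → Record → Option ℕ) := by
  -- Two lawful equality tests on the keys coincide; only the one from decidable equality fits
  -- `Primrec.listLookup`.
  have h : (instBEqProd : BEq (ℕ × ℕ)) = instBEqOfDecidableEq := lawful_beq_subsingleton _ _
  rw [h]
  exact Primrec.listLookup

theorem primrecPred_ready (j : ℕ) :
    PrimrecPred fun s : LocalInput × Record => P.Ready s.1 s.2 j := by
  have h0 : Primrec fun a : (ℕ × ℕ) × (LocalInput × Record) => (a.2.2.lookup a.1).isSome :=
    Primrec.option_isSome.comp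
      (primrec_lookup.comp Primrec.fst (Primrec.snd.comp Primrec.snd))
  have h1 : PrimrecRel fun (k : ℕ × ℕ) (s : LocalInput × Record) => (s.2.lookup k).isSome = true :=
    PrimrecRel.comp (R := Eq) Primrec.eq h0 (Primrec.const true)
  have h2 : PrimrecPred fun s : LocalInput × Record =>
      ∀ k ∈ P.need j s.1, (s.2.lookup k).isSome = true :=
    PrimrecRel.comp h1.forall_mem_list ((P.primrec_need j).comp Primrec.fst) Primrec.id
  exact (primrecPred_awake.and h2).of_eq fun s => Iff.rfl

theorem primrec_fire (j : ℕ) : Primrec fun s : LocalInput × Record => P.fire s.1 s.2 j := by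
  refine Primrec.ite (P.primrecPred_ready j) (Primrec.option_some.comp ?_) (Primrec.const none)
  refine (P.primrec_out j).comp Primrec.fst ?_
  refine Primrec.listFilterMap ((P.primrec_need j).comp Primrec.fst) ?_
  exact primrec_lookup.comp Primrec.snd (Primrec.snd.comp Primrec.fst)

theorem primrec_fresh {α : Type*} [Primcodable α] {old : α → ℕ → Bool} {l : α → LocalInput}
    {h : α → Record} (hold : ∀ j, Primrec fun a => old a j) (hl : Primrec l) (hh : Primrec h) :
    Primrec fun a => P.fresh (old a) (l a) (h a) := by
  refine primrec_filterMap_const (List.range (P.last + 1)) (fun j a =>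
    if old a j = true then none else (P.fire (l a) (h a) j).map (Nat.pair j)) fun j => ?_
  have h1 : PrimrecPred fun a => old a j = true :=
    PrimrecRel.comp (R := Eq) Primrec.eq (hold j) (Primrec.const true)
  have h2 : Primrec fun a => P.fire (l a) (h a) j := (P.primrec_fire j).comp (Primrec.pair hl hh)
  have h3 : Primrec₂ fun (_ : α) (x : ℕ) => Nat.pair j x :=
    Primrec₂.natPair.comp (Primrec.const j) Primrec.snd
  exact Primrec.ite h1 (Primrec.const none) (Primrec.option_map h2 h3)

theorem primrec_broadcast : Primrec₂ broadcast := by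
  refine Primrec.list_flatMap Primrec.snd ?_
  refine Primrec.list_map (Primrec.list_range.comp (Primrec.fst.comp Primrec.fst)) ?_
  exact Primrec.pair Primrec.snd (Primrec.snd.comp Primrec.fst)

theorem primrec_record : Primrec₂ record := by
  have h : Primrec fun a : Record × (ℕ × ℕ) => a.2.2.unpair :=
    Primrec.unpair.comp (Primrec.snd.comp Primrec.snd)
  refine Primrec.list_cons.comp (Primrec.pair (Primrec.pair ?_ ?_) ?_) Primrec.fst
  · exact Primrec.fst.comp Primrec.snd
  · exact Primrec.fst.comp h
  · exact Primrec.snd.comp h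

theorem primrec_degree : Primrec fun l : LocalInput => l.2.2.length :=
  Primrec.list_length.comp (Primrec.snd.comp Primrec.snd)

/-- The reaction to the receipt of a message: everything that has become computable is sent. -/
def receiveStep (s : LocalInput × Record) (e : ℕ × ℕ) :
    (LocalInput × Record) × List (ℕ × ℕ) :=
  ((s.1, record s.2 e),
    broadcast s.1.2.2.length (P.fresh (fun j => (P.fire s.1 s.2 j).isSome) s.1 (record s.2 e)))

theorem primrec_receiveStep : Primrec₂ P.receiveStep := by
  have hl : Primrec fun a : (LocalInput × Record) × (ℕ × ℕ) => a.1.1 :=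
    Primrec.fst.comp Primrec.fst
  have hr : Primrec fun a : (LocalInput × Record) × (ℕ × ℕ) => record a.1.2 a.2 :=
    primrec_record.comp (Primrec.snd.comp Primrec.fst) Primrec.snd
  have hs : Primrec fun a : (LocalInput × Record) × (ℕ × ℕ) => (a.1.1, record a.1.2 a.2) :=
    Primrec.pair hl hr
  have hold (j : ℕ) : Primrec fun a : (LocalInput × Record) × (ℕ × ℕ) =>
      (P.fire a.1.1 a.1.2 j).isSome :=
    Primrec.option_isSome.comp ((P.primrec_fire j).comp Primrec.fst)
  have hfresh : Primrec fun a : (LocalInput × Record) × (ℕ × ℕ) =>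
      P.fresh (fun j => (P.fire a.1.1 a.1.2 j).isSome) a.1.1 (record a.1.2 a.2) :=
    P.primrec_fresh hold hl hr
  have hdeg : Primrec fun a : (LocalInput × Record) × (ℕ × ℕ) => a.1.1.2.2.length :=
    primrec_degree.comp hl
  have hbr : Primrec fun a : (LocalInput × Record) × (ℕ × ℕ) => broadcast a.1.1.2.2.length
      (P.fresh (fun j => (P.fire a.1.1 a.1.2 j).isSome) a.1.1 (record a.1.2 a.2)) :=
    primrec_broadcast.comp hdeg hfresh
  exact Primrec.pair hs hbr

/-- The verdict is reached when the payload for the last tag can be computed. -/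
def verdict (s : LocalInput × Record) : Option Bool := (P.fire s.1 s.2 P.last).map P.final

theorem primrec_verdict :
    Primrec fun s : LocalInput × Record => P.verdict s := by
  have h : Primrec₂ fun (_ : LocalInput × Record) (m : ℕ) => P.final m :=
    P.primrec_final.comp Primrec.snd
  exact Primrec.option_map (P.primrec_fire P.last) h

/-- The distributed algorithm that runs the program: a message is sent through all ports as soon as
the node is awake and has received everything the message depends on. -/
def toAlgorithm : DistAlgorithm where
  State := LocalInput × Record
  init l := (l, [])
  start s := (s, broadcast s.1.2.2.length (P.fresh (fun _ => false) s.1 s.2))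
  receive := P.receiveStep
  verdict := P.verdict
  computable_init := (Primrec.pair Primrec.id (Primrec.const [])).to_comp
  computable_start := by
    refine Primrec.to_comp (Primrec.pair Primrec.id (primrec_broadcast.comp ?_ ?_))
    · exact primrec_degree.comp Primrec.fst
    · exact P.primrec_fresh (fun _ => Primrec.const false) Primrec.fst Primrec.snd
  computable_receive := P.primrec_receiveStep.to_comp
  computable_verdict := P.primrec_verdict.to_comp

end DataflowProgram

/-! ### Ports and neighbours -/

namespace Network

variable {V : Type} [Fintype V]

/-- The neighbour of `v` at port `i`, and `v` itself if there is no such port. -/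
def atPort (N : Network V) (v : V) (i : ℕ) : V := (N.ports v).getD i v

theorem atPort_adj (N : Network V) {v : V} {i : ℕ} (h : i < (N.ports v).length) :
    N.graph.Adj v (N.atPort v i) := by
  rw [← N.mem_ports, atPort, List.getD_eq_getElem _ _ h]
  exact List.getElem_mem h

variable [DecidableEq V]

theorem atPort_idxOf (N : Network V) {v u : V} (h : N.graph.Adj v u) :
    N.atPort v ((N.ports v).idxOf u) = u := by
  have hm := (N.mem_ports v u).2 h
  simp [atPort, List.getD_eq_getElem?_getD, List.getElem?_idxOf hm]

theorem idxOf_atPort (N : Network V) {v : V} {i : ℕ} (h : i < (N.ports v).length) :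
    (N.ports v).idxOf (N.atPort v i) = i := by
  rw [atPort, List.getD_eq_getElem _ _ h]
  exact (N.ports_nodup v).idxOf_getElem i h

theorem localInput_degree (N : Network V) (v : V) :
    (N.localInput v).2.2.length = (N.ports v).length := by
  simp [localInput]

theorem localInput_parent_eq_none (N : Network V) (v : V) :
    (N.localInput v).2.1 = none ↔ v = N.root := by
  simp [localInput]

end Network

/-! ### Solutions of the dataflow equations and the run invariant -/

namespace DataflowProgram

variable {V : Type} [Fintype V] [DecidableEq V] (P : DataflowProgram) (N : Network V)
  (val : V → ℕ → ℕ)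

/-- `val v j` are the payloads that `v` broadcasts for the tag `j` when `P` runs on `N`. -/
structure Solves : Prop where
  val_eq : ∀ v j, j ≤ P.last → val v j = P.out j (N.localInput v)
    ((P.need j (N.localInput v)).map fun k => val (N.atPort v k.1) k.2)
  need_mem : ∀ v j, j ≤ P.last → ∀ k ∈ P.need j (N.localInput v),
    k.1 < (N.ports v).length ∧ k.2 ≤ P.last
  need_zero : ∀ v, P.need 0 (N.localInput v) = []
  rank : ∃ r : V → ℕ → ℕ, ∀ v j, j ≤ P.last → ∀ k ∈ P.need j (N.localInput v),
    r (N.atPort v k.1) k.2 < r v j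

/-- The record `h` of `v` contains only correct messages. -/
def Valid (v : V) (h : Record) : Prop :=
  ∀ e ∈ h, ∃ u j, N.graph.Adj v u ∧ j ≤ P.last ∧ e = (((N.ports v).idxOf u, j), val u j)

variable {P N val}

theorem lookup_cons_isSome {h : Record} {k : ℕ × ℕ} (e) (hk : (h.lookup k).isSome = true) :
    (List.lookup k (e :: h)).isSome = true := by
  rw [List.lookup_isSome_iff] at hk ⊢
  obtain ⟨p, hp, hk⟩ := hk
  exact ⟨p, List.mem_cons_of_mem _ hp, hk⟩

theorem lookup_isSome_of_mem {h : Record} {k : ℕ × ℕ} {x : ℕ} (hk : (k, x) ∈ h) :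
    (h.lookup k).isSome = true := by
  rw [List.lookup_isSome_iff]
  exact ⟨(k, x), hk, by simp⟩

theorem Ready.cons {l : LocalInput} {h : Record} {j : ℕ} (hr : P.Ready l h j) (e) :
    P.Ready l (e :: h) j :=
  ⟨Or.inr (by simp), fun k hk => lookup_cons_isSome e (hr.2 k hk)⟩

theorem Valid.lookup {v : V} {h : Record} (hv : P.Valid N val v h) {k : ℕ × ℕ}
    (hk : (h.lookup k).isSome = true) : h.lookup k = some (val (N.atPort v k.1) k.2) := by
  obtain ⟨b, hb⟩ := Option.isSome_iff_exists.1 hk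
  rw [hb]
  obtain ⟨l₁, l₂, rfl, -⟩ := List.lookup_eq_some_iff.1 hb
  obtain ⟨u, j, hu, -, he⟩ := hv (k, b) (by simp)
  obtain ⟨rfl, rfl⟩ := Prod.mk.inj he
  simp [N.atPort_idxOf hu]

/-- On a valid record every successful lookup returns the true payload, so the order of arrival has
no influence on what is computed. -/
theorem fire_eq (hs : P.Solves N val) {v : V} {h : Record} (hv : P.Valid N val v h) {j : ℕ}
    (hj : j ≤ P.last) : P.fire (N.localInput v) h j =
      if P.Ready (N.localInput v) h j then some (val v j) else none := by
  unfold fire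
  split_ifs with hr
  · rw [hs.val_eq v j hj]
    congr 2
    rw [← List.filterMap_eq_map]
    exact List.filterMap_congr fun k hk => hv.lookup (hr.2 k hk)
  · rfl

theorem fire_isSome {l : LocalInput} {h : Record} {j : ℕ} :
    (P.fire l h j).isSome = decide (P.Ready l h j) := by
  unfold fire
  split_ifs with hr <;> simp [hr]

theorem nodup_fresh (old : ℕ → Bool) (l : LocalInput) (h : Record) : (P.fresh old l h).Nodup := by
  refine List.Nodup.filterMap ?_ List.nodup_range
  intro a a' b hb hb'
  split_ifs at hb hb' <;> simp_all
  obtain ⟨x, -, rfl⟩ := hb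
  obtain ⟨y, -, hy⟩ := hb'
  exact (Nat.pair_eq_pair.1 hy).1.symm

theorem mem_fresh (hs : P.Solves N val) {v : V} {h : Record} (hv : P.Valid N val v h)
    {old : ℕ → Bool} {m : ℕ} : m ∈ P.fresh old (N.localInput v) h ↔
      ∃ j ≤ P.last, old j = false ∧ P.Ready (N.localInput v) h j ∧ m = Nat.pair j (val v j) := by
  simp only [fresh, List.mem_filterMap, List.mem_range, Nat.lt_succ_iff]
  refine exists_congr fun j => and_congr_right fun hj => ?_
  rw [fire_eq hs hv hj]
  cases old j <;> by_cases hr : P.Ready (N.localInput v) h j <;> simp [hr, eq_comm]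

theorem emit_broadcast (v : V) (ms : List ℕ) :
    DistAlgorithm.emit N v (broadcast (N.ports v).length ms) =
      ((ms ×ˢ N.ports v).map fun p => (v, p.2, p.1) : List (V × V × ℕ)) := by
  unfold DistAlgorithm.emit broadcast
  congr 1
  induction ms with
  | nil => rfl
  | cons m ms ih =>
    rw [List.flatMap_cons, List.filterMap_append, ih, List.product_cons, List.map_append]
    congr 1
    rw [List.filterMap_map, List.map_map]
    generalize N.ports v = L
    induction L using List.reverseRecOn with
    | nil => rfl
    | append_singleton L u ihL =>
      rw [List.length_append, List.length_singleton, List.range_succ, List.filterMap_append,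
        List.map_append]
      congr 1
      · rw [← ihL]
        refine List.filterMap_congr fun i hi => ?_
        simp [List.getElem?_append_left (List.mem_range.1 hi)]
      · simp

theorem mem_emit_broadcast {v : V} {ms : List ℕ} {e : V × V × ℕ} :
    e ∈ DistAlgorithm.emit N v (broadcast (N.ports v).length ms) ↔
      e.1 = v ∧ N.graph.Adj v e.2.1 ∧ e.2.2 ∈ ms := by
  obtain ⟨a, b, m⟩ := e
  rw [emit_broadcast, Multiset.mem_coe, List.mem_map]
  simp only [Prod.exists, List.mem_product, N.mem_ports, Prod.mk.injEq]
  constructor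
  · rintro ⟨m', u, ⟨h1, h2⟩, rfl, rfl, rfl⟩
    exact ⟨rfl, h2, h1⟩
  · rintro ⟨rfl, h2, h1⟩
    exact ⟨m, b, ⟨h1, h2⟩, rfl, rfl, rfl⟩

theorem nodup_emit_broadcast (v : V) {ms : List ℕ} (h : ms.Nodup) :
    (DistAlgorithm.emit N v (broadcast (N.ports v).length ms)).Nodup := by
  rw [emit_broadcast, Multiset.coe_nodup]
  refine List.Nodup.map ?_ (h.product (N.ports_nodup v))
  rintro ⟨a, b⟩ ⟨c, d⟩ h
  simp_all

theorem count_emit_fresh (hs : P.Solves N val) {w : V} {h : Record} (hv : P.Valid N val w h)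
    (old : ℕ → Bool) {u v : V} (huv : N.graph.Adj u v) {j : ℕ} (hj : j ≤ P.last) :
    (DistAlgorithm.emit N w (broadcast (N.localInput w).2.2.length
      (P.fresh old (N.localInput w) h))).count (u, v, Nat.pair j (val u j)) =
      if u = w ∧ old j = false ∧ P.Ready (N.localInput w) h j then 1 else 0 := by
  rw [N.localInput_degree, Multiset.count_eq_of_nodup
    (nodup_emit_broadcast w (nodup_fresh _ _ _))]
  refine if_congr ?_ rfl rfl
  rw [mem_emit_broadcast]
  constructor
  · rintro ⟨h1, -, h3⟩
    obtain rfl : u = w := h1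
    obtain ⟨i, -, hi, hr, he⟩ := (mem_fresh hs hv).1 h3
    obtain rfl : j = i := (Nat.pair_eq_pair.1 he).1
    exact ⟨rfl, hi, hr⟩
  · rintro ⟨rfl, ho, hr⟩
    exact ⟨rfl, huv, (mem_fresh hs hv).2 ⟨j, hj, ho, hr, rfl⟩⟩

variable (P N val)

/-- What holds in all configurations that are reached when `P` runs on `N`. -/
structure Invariant (c : Configuration V (LocalInput × Record)) : Prop where
  input : ∀ v, (c.state v).1 = N.localInput v
  valid : ∀ v, P.Valid N val v (c.state v).2
  sent_mem : ∀ e ∈ c.sent, ∃ u v j, N.graph.Adj u v ∧ j ≤ P.last ∧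
    e = (u, v, Nat.pair j (val u j))
  transit_le : c.transit ≤ c.sent
  count_sent : ∀ u v j, N.graph.Adj u v → j ≤ P.last →
    c.sent.count (u, v, Nat.pair j (val u j)) =
      if P.Ready (N.localInput u) (c.state u).2 j then 1 else 0
  count_record : ∀ u v j, N.graph.Adj u v → j ≤ P.last →
    (c.state v).2.count (((N.ports v).idxOf u, j), val u j) +
      c.transit.count (u, v, Nat.pair j (val u j)) = c.sent.count (u, v, Nat.pair j (val u j))

variable {P N val}

theorem valid_nil (v : V) : P.Valid N val v [] := fun _ he => absurd he List.not_mem_nil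

theorem sent_mem_emit (hs : P.Solves N val) {w : V} {h : Record} (hv : P.Valid N val w h)
    {old : ℕ → Bool} {e : V × V × ℕ}
    (he : e ∈ DistAlgorithm.emit N w (broadcast (N.localInput w).2.2.length
      (P.fresh old (N.localInput w) h))) :
    ∃ u v j, N.graph.Adj u v ∧ j ≤ P.last ∧ e = (u, v, Nat.pair j (val u j)) := by
  rw [N.localInput_degree, mem_emit_broadcast] at he
  obtain ⟨h1, h2, h3⟩ := he
  obtain ⟨j, hj, -, -, hm⟩ := (mem_fresh hs hv).1 h3
  refine ⟨w, e.2.1, j, h2, hj, ?_⟩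
  rw [← h1, ← h1] at *
  rw [← hm]

theorem invariant_initialConfig (hs : P.Solves N val) :
    P.Invariant N val (P.toAlgorithm.initialConfig N) := by
  have hst : (P.toAlgorithm.initialConfig N).state = fun v => (N.localInput v, []) := by
    -- The first step sends messages but leaves the state of the requesting node unchanged.
    exact Function.update_eq_self (f := fun v => (N.localInput v, ([] : Record))) N.root
  have hsent : (P.toAlgorithm.initialConfig N).sent = DistAlgorithm.emit N N.root
    (broadcast (N.localInput N.root).2.2.length
      (P.fresh (fun _ => false) (N.localInput N.root) [])) := rfl
  have htr : (P.toAlgorithm.initialConfig N).transit = (P.toAlgorithm.initialConfig N).sent := rfl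
  have hcs : ∀ u, ((P.toAlgorithm.initialConfig N).state u : LocalInput × Record).2 = [] := by
    intro u; rw [hst]
  refine ⟨?_, ?_, ?_, ?_, ?_, ?_⟩
  · intro v; rw [hst]
  · intro v; rw [hcs]; exact valid_nil v
  · intro e he
    rw [hsent] at he
    exact sent_mem_emit hs (valid_nil _) he
  · rw [htr]
  · intro u v j huv hj
    rw [hsent, count_emit_fresh hs (valid_nil _) _ huv hj, hcs]
    refine if_congr ?_ rfl rfl
    constructor
    · rintro ⟨rfl, -, h⟩; exact h
    · intro h
      -- With an empty record only the requesting node is awake.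
      have : u = N.root := by
        simpa [Awake, N.localInput_parent_eq_none] using h.1
      subst this
      exact ⟨rfl, rfl, h⟩
  · intro u v j huv hj
    rw [hcs, htr]; simp

/-- Only the record of `v` changes. A payload is sent exactly when it turns ready, and the delivered
message moves from transit into the record, which preserves the balance in `count_record`. -/
theorem invariant_deliver (hs : P.Solves N val) {c : Configuration V (LocalInput × Record)}
    (hc : P.Invariant N val c) {u v : V} {m : ℕ} (he : (u, v, m) ∈ c.transit) :
    P.Invariant N val (P.toAlgorithm.deliver N c u v m) := by
  obtain ⟨u₀, v₀, j₀, huv, hj₀, heq⟩ := hc.sent_mem _ (Multiset.mem_of_le hc.transit_le he)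
  obtain ⟨rfl, rfl, rfl⟩ : u = u₀ ∧ v = v₀ ∧ m = Nat.pair j₀ (val u j₀) := by
    simp only [Prod.mk.injEq] at heq
    obtain ⟨rfl, rfl, rfl⟩ := heq
    exact ⟨rfl, rfl, rfl⟩
  set h' : Record := (((N.ports v).idxOf u, j₀), val u j₀) :: (c.state v).2 with hh'
  set em : Multiset (V × V × ℕ) := DistAlgorithm.emit N v
    (broadcast (N.localInput v).2.2.length
      (P.fresh (fun j => (P.fire (N.localInput v) (c.state v).2 j).isSome) (N.localInput v) h'))
    with hem
  have hst : (P.toAlgorithm.deliver N c u v (Nat.pair j₀ (val u j₀))).state =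
      Function.update c.state v (N.localInput v, h') := by
    rw [hh', ← hc.input v]
    simp [DistAlgorithm.deliver, toAlgorithm, receiveStep, record]
  have hr : P.toAlgorithm.receive (c.state v)
      ((N.ports v).idxOf u, Nat.pair j₀ (val u j₀)) = ((N.localInput v, h'),
        broadcast (N.localInput v).2.2.length
      (P.fresh (fun j => (P.fire (N.localInput v) (c.state v).2 j).isSome) (N.localInput v) h')) := by
    rw [hh', ← hc.input v]
    simp [toAlgorithm, receiveStep, record]
  have htr : (P.toAlgorithm.deliver N c u v (Nat.pair j₀ (val u j₀))).transit =
      c.transit.erase (u, v, Nat.pair j₀ (val u j₀)) + em := by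
    rw [hem]; unfold DistAlgorithm.deliver; simp only; rw [hr]
  have hsent : (P.toAlgorithm.deliver N c u v (Nat.pair j₀ (val u j₀))).sent = c.sent + em := by
    rw [hem]; unfold DistAlgorithm.deliver; simp only; rw [hr]
  have hcv : ((P.toAlgorithm.deliver N c u v (Nat.pair j₀ (val u j₀))).state v :
      LocalInput × Record).2 = h' := by
    rw [hst]; simp
  have hcn : ∀ w, w ≠ v → ((P.toAlgorithm.deliver N c u v (Nat.pair j₀ (val u j₀))).state w :
      LocalInput × Record) = c.state w := by
    intro w hw; rw [hst]; exact Function.update_of_ne hw _ _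
  have hval : P.Valid N val v h' := by
    intro e he
    rcases List.mem_cons.1 he with rfl | he
    · exact ⟨u, j₀, huv.symm, hj₀, rfl⟩
    · exact hc.valid v e he
  refine ⟨?_, ?_, ?_, ?_, ?_, ?_⟩
  · intro w
    by_cases hw : w = v
    · subst hw; rw [hst]; simp
    · rw [hcn w hw, hc.input]
  · intro w
    by_cases hw : w = v
    · subst hw; rw [hcv]; exact hval
    · rw [hcn w hw]; exact hc.valid w
  · intro e he
    rw [hsent] at he
    rcases Multiset.mem_add.1 he with he | he
    · exact hc.sent_mem e he
    · exact sent_mem_emit hs hval he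
  · rw [htr, hsent]
    exact add_le_add_left ((Multiset.erase_le _ _).trans hc.transit_le) _
  · intro a b j hab hj
    rw [hsent, Multiset.count_add, hc.count_sent a b j hab hj, hem,
      count_emit_fresh hs hval _ hab hj]
    by_cases ha : a = v
    · subst ha
      rw [hcv]
      simp only [fire_isSome]
      -- Readiness survives a longer record, and a tag that was ready before is suppressed by `old`,
      -- so no second copy is sent.
      by_cases h1 : P.Ready (N.localInput a) (c.state a).2 j
      · have h2 : P.Ready (N.localInput a) h' j := h1.cons _
        simp [h1, h2]
      · simp [h1]
    · rw [hcn a ha]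
      simp [ha]
  · intro a b j hab hj
    rw [hsent, htr, Multiset.count_add, Multiset.count_add, ← hc.count_record a b j hab hj,
      ← add_assoc]
    congr 1
    by_cases hb : b = v
    · subst hb
      rw [hcv, hh', List.count_cons]
      by_cases hk : a = u ∧ j = j₀
      · obtain ⟨rfl, rfl⟩ := hk
        have : 0 < c.transit.count (a, b, Nat.pair j (val a j)) := Multiset.count_pos.2 he
        simp [Multiset.count_erase_self]
        omega
      · have h1 : (a, b, Nat.pair j (val a j)) ≠ (u, b, Nat.pair j₀ (val u j₀)) := by
          intro h
          simp only [Prod.mk.injEq, Nat.pair_eq_pair] at h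
          exact hk ⟨h.1, h.2.2.1⟩
        have h2 : (((N.ports b).idxOf u, j₀), val u j₀) ≠
            (((N.ports b).idxOf a, j), val a j) := by
          intro h
          simp only [Prod.mk.injEq] at h
          -- The port index determines the neighbour.
          have := (N.atPort_idxOf huv.symm).symm.trans
            ((congrArg (N.atPort b) h.1.1).trans (N.atPort_idxOf hab.symm))
          exact hk ⟨this.symm, h.1.2.symm⟩
        rw [Multiset.count_erase_of_ne h1]
        simp [h2]
    · rw [hcn b hb]
      have h1 : (a, b, Nat.pair j (val a j)) ≠ (u, v, Nat.pair j₀ (val u j₀)) := by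
        intro h
        simp only [Prod.mk.injEq] at h
        exact hb h.2.1
      rw [Multiset.count_erase_of_ne h1]

end DataflowProgram

/-! ### Termination, verdict and message complexity -/

namespace DataflowProgram

variable {V : Type} [Fintype V] [DecidableEq V] {P : DataflowProgram} {N : Network V}
  {val : V → ℕ → ℕ}

theorem invariant_run (hs : P.Solves N val) {c : ℕ → Configuration V (LocalInput × Record)}
    (hc : P.toAlgorithm.IsRun N c) (t : ℕ) : P.Invariant N val (c t) := by
  induction t with
  | zero => rw [hc.1]; exact invariant_initialConfig hs
  | succ t ih =>
    rcases hc.2 t with ⟨u, v, m, he, h⟩ | ⟨-, h⟩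
    · rw [h]; exact invariant_deliver hs ih he
    · rw [h]; exact ih

namespace Invariant

variable {c : Configuration V (LocalInput × Record)}

theorem nodup_sent (hc : P.Invariant N val c) : c.sent.Nodup := by
  rw [Multiset.nodup_iff_count_eq_one]
  intro e he
  obtain ⟨u, v, j, huv, hj, rfl⟩ := hc.sent_mem e he
  have h := hc.count_sent u v j huv hj
  have := Multiset.one_le_count_iff_mem.2 he
  split_ifs at h <;> omega

/-- Sender, receiver and tag determine a message. This crude bound, uniform in time, forces
termination. -/
theorem card_sent_le (hc : P.Invariant N val c) :
    Multiset.card c.sent ≤ Fintype.card (V × V × Fin (P.last + 1)) := by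
  classical
  let f : V × V × Fin (P.last + 1) → V × V × ℕ :=
    fun x => (x.1, x.2.1, Nat.pair x.2.2 (val x.1 x.2.2))
  have h : (⟨c.sent, hc.nodup_sent⟩ : Finset (V × V × ℕ)) ⊆ Finset.univ.image f := by
    intro e he
    obtain ⟨u, v, j, huv, hj, rfl⟩ := hc.sent_mem e he
    exact Finset.mem_image.2 ⟨(u, v, ⟨j, Nat.lt_succ_of_le hj⟩), Finset.mem_univ _, rfl⟩
  exact (Finset.card_le_card h).trans Finset.card_image_le

theorem card_link_le (hc : P.Invariant N val c) (u v : V) :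
    Multiset.card (c.sent.filter fun e => s(e.1, e.2.1) = s(u, v)) ≤ 2 * (P.last + 1) := by
  classical
  let f : Bool × Fin (P.last + 1) → V × V × ℕ := fun x =>
    bif x.1 then (u, v, Nat.pair x.2 (val u x.2)) else (v, u, Nat.pair x.2 (val v x.2))
  have h : (⟨c.sent.filter fun e => s(e.1, e.2.1) = s(u, v), hc.nodup_sent.filter _⟩ :
      Finset (V × V × ℕ)) ⊆ Finset.univ.image f := by
    intro e he
    obtain ⟨he, huv⟩ := Multiset.mem_filter.1 he
    obtain ⟨a, b, j, -, hj, rfl⟩ := hc.sent_mem e he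
    rw [Finset.mem_image]
    rcases Sym2.eq_iff.1 huv with ⟨h1, h2⟩ | ⟨h1, h2⟩
    · simp only at h1 h2
      subst h1 h2
      exact ⟨(true, ⟨j, Nat.lt_succ_of_le hj⟩), Finset.mem_univ _, rfl⟩
    · simp only at h1 h2
      subst h1 h2
      exact ⟨(false, ⟨j, Nat.lt_succ_of_le hj⟩), Finset.mem_univ _, rfl⟩
  refine (Finset.card_le_card h).trans (Finset.card_image_le.trans ?_)
  simp

/-- When no message is in transit, every node has computed all its payloads. -/
theorem ready_of_transit_eq_zero (hs : P.Solves N val) (hc : P.Invariant N val c)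
    (h0 : c.transit = 0) (v : V) {j : ℕ} (hj : j ≤ P.last) :
    P.Ready (N.localInput v) (c.state v).2 j := by
  -- With nothing in transit, whatever was sent has been recorded by its receiver.
  have key : ∀ u v j, N.graph.Adj u v → j ≤ P.last →
      P.Ready (N.localInput u) (c.state u).2 j →
      (((N.ports v).idxOf u, j), val u j) ∈ (c.state v).2 := by
    intro u v j huv hj hr
    have h1 := hc.count_record u v j huv hj
    rw [h0, hc.count_sent u v j huv hj, if_pos hr] at h1
    rw [← List.count_pos_iff]
    simp only [Multiset.count_zero] at h1
    omega
  -- Tag `0` depends on nothing, so it acts as the wake-up call.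
  have hzero : ∀ v, Awake (N.localInput v) (c.state v).2 →
      P.Ready (N.localInput v) (c.state v).2 0 := by
    intro v h
    exact ⟨h, by simp [hs.need_zero]⟩
  have hawake : ∀ v, Awake (N.localInput v) (c.state v).2 := by
    intro v
    have hroot : Awake (N.localInput N.root) (c.state N.root).2 :=
      Or.inl ((N.localInput_parent_eq_none _).2 rfl)
    -- The wake-up call has travelled along this walk, starting from the requesting node at its end.
    obtain ⟨w⟩ := N.connected.preconnected v N.root
    generalize N.root = ρ at w hroot
    induction w with
    | nil => exact hroot
    | cons huv _ ih =>
      exact Or.inr (List.ne_nil_of_mem (key _ _ 0 huv.symm (Nat.zero_le _) (hzero _ (ih hroot))))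
  obtain ⟨r, hr⟩ := hs.rank
  induction hn : r v j using Nat.strong_induction_on generalizing v j with
  | _ n ih =>
    refine ⟨hawake v, fun k hk => ?_⟩
    obtain ⟨hk1, hk2⟩ := hs.need_mem v j hj k hk
    have h1 := ih _ (hn ▸ hr v j hj k hk) _ hk2 rfl
    have h2 := key _ _ _ (N.atPort_adj hk1).symm hk2 h1
    rw [N.idxOf_atPort hk1] at h2
    exact lookup_isSome_of_mem h2

end Invariant

/-- Each delivery consumes one message, so after `t` deliveries the number sent exceeds the number
in transit by `t`; but the number sent is bounded. -/
theorem exists_transit_eq_zero (hs : P.Solves N val)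
    {c : ℕ → Configuration V (LocalInput × Record)} (hc : P.toAlgorithm.IsRun N c) :
    ∃ t, (c t).transit = 0 := by
  by_contra! hne
  have h : ∀ t, Multiset.card (c t).sent = Multiset.card (c t).transit + t := by
    intro t
    induction t with
    | zero => rw [hc.1]; rfl
    | succ t ih =>
      rcases hc.2 t with ⟨u, v, m, he, h⟩ | ⟨h, -⟩
      · rw [h]
        have := Multiset.card_erase_add_one he
        simp only [DistAlgorithm.deliver, Multiset.card_add]
        omega
      · exact absurd h (hne t)
  have h1 := (invariant_run hs hc (Fintype.card (V × V × Fin (P.last + 1)) + 1)).card_sent_le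
  rw [h] at h1
  omega

theorem ready_mono_run {c : ℕ → Configuration V (LocalInput × Record)}
    (hc : P.toAlgorithm.IsRun N c) (v : V) (j : ℕ) {t t' : ℕ} (htt' : t ≤ t')
    (h : P.Ready (N.localInput v) ((c t).state v).2 j) :
    P.Ready (N.localInput v) ((c t').state v).2 j := by
  induction t', htt' using Nat.le_induction with
  | base => exact h
  | succ t' _ ih =>
    rcases hc.2 t' with ⟨a, b, m, he, h⟩ | ⟨-, h⟩
    · rw [h]
      by_cases hb : v = b
      · subst hb
        have : ((P.toAlgorithm.deliver N (c t') a v m).state v : LocalInput × Record) =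
            (((c t').state v).1, record ((c t').state v).2 ((N.ports v).idxOf a, m)) := by
          exact Function.update_self v _ _
        rw [this]
        exact ih.cons _
      · have : ((P.toAlgorithm.deliver N (c t') a b m).state v : LocalInput × Record) =
            (c t').state v := Function.update_of_ne hb _ _
        rw [this]
        exact ih
    · rw [h]; exact ih

/-- The requesting node reaches its verdict in every run, and keeps it. -/
theorem exists_verdict (hs : P.Solves N val) {c : ℕ → Configuration V (LocalInput × Record)}
    (hc : P.toAlgorithm.IsRun N c) :
    ∃ t, ∀ t', P.verdict ((c t').state N.root) =
      if t ≤ t' then some (P.final (val N.root P.last)) else none := by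
  have hex : ∃ t, P.Ready (N.localInput N.root) ((c t).state N.root).2 P.last := by
    obtain ⟨t, ht⟩ := exists_transit_eq_zero hs hc
    exact ⟨t, (invariant_run hs hc t).ready_of_transit_eq_zero hs ht _ le_rfl⟩
  -- Readiness is monotone in time, so the verdict appears at the first ready moment and stays.
  refine ⟨Nat.find hex, fun t' => ?_⟩
  have hi := invariant_run hs hc t'
  rw [verdict, hi.input, fire_eq hs (hi.valid _) le_rfl]
  split_ifs with h1 h2 h2
  · rfl
  · exact absurd (Nat.find_min' hex h1) h2
  · exact absurd (ready_mono_run hc _ _ h2 (Nat.find_spec hex)) h1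
  · rfl

/-- A program evaluates a sentence if its dataflow equations have a solution on every network, with
the right value at the requesting node. It does so frugally if the payloads are polynomially
bounded in the number of nodes. -/
theorem frugallyEvaluable (P : DataflowProgram) (C : ∀ V : Type, SimpleGraph V → Prop)
    (φ : Language.graph.Sentence) (b : ℕ)
    (h : ∀ (V : Type) [Fintype V] [DecidableEq V] (N : Network V), C V N.graph →
      ∃ val : V → ℕ → ℕ, P.Solves N val ∧
        (P.final (val N.root P.last) = true ↔
          @Language.Sentence.Realize Language.graph V N.graph.structure φ) ∧
        (2 ≤ Fintype.card V → ∀ v, ∀ j ≤ P.last, Nat.pair j (val v j) ≤ Fintype.card V ^ b)) :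
    FrugallyEvaluable C φ := by
  -- Each link carries each tag at most once per direction. With `L` the logarithm, at least `1`,
  -- the last inequality below is `(L + 1) * b ≤ 2 * b * L < (2 * b + 1) * L`.
  refine ⟨P.toAlgorithm, ?_, 2 * (P.last + 1), 2 * b + 1, ?_⟩
  · intro V _ _ N hN c hc
    obtain ⟨val, hs, hv, -⟩ := h V N hN
    obtain ⟨t, ht⟩ := exists_verdict hs hc
    exact ⟨_, t, ht, hv⟩
  · intro V _ _ N hN c hc t
    obtain ⟨val, hs, -, hb⟩ := h V N hN
    have hi := invariant_run hs hc t
    refine ⟨fun u v _ => hi.card_link_le u v, fun e he => ?_⟩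
    obtain ⟨u, v, j, huv, hj, rfl⟩ := hi.sent_mem e he
    -- A message has two distinct endpoints; a one-node network, where the logarithm vanishes, sends
    -- nothing.
    have h2 : 2 ≤ Fintype.card V := Fintype.one_lt_card_iff.2 ⟨u, v, huv.ne⟩
    have h1 : 1 ≤ Nat.log 2 (Fintype.card V) := Nat.log_pos one_lt_two h2
    have hlt : Fintype.card V < 2 ^ (Nat.log 2 (Fintype.card V) + 1) :=
      Nat.lt_pow_succ_log_self one_lt_two _
    simp only
    rw [Nat.size_le]
    calc Nat.pair j (val u j) ≤ Fintype.card V ^ b := hb h2 u j hj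
      _ ≤ (2 ^ (Nat.log 2 (Fintype.card V) + 1)) ^ b := Nat.pow_le_pow_left hlt.le b
      _ = 2 ^ ((Nat.log 2 (Fintype.card V) + 1) * b) := (pow_mul _ _ _).symm
      _ < 2 ^ ((2 * b + 1) * Nat.log 2 (Fintype.card V)) := by
        refine Nat.pow_lt_pow_right one_lt_two ?_
        nlinarith

end DataflowProgram

namespace Network

variable {V V' : Type} [Fintype V] [Fintype V'] {d : ℕ}

/-! ### Walks along port numbers -/

/-- The node reached from `v` along a list of port numbers; missing ports are skipped. -/
def walk (N : Network V) (v : V) (w : List (Fin d)) : V := w.foldl (fun x i => N.atPort x i) v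

@[simp]
theorem walk_nil (N : Network V) (v : V) : N.walk v ([] : List (Fin d)) = v := rfl

@[simp]
theorem walk_cons (N : Network V) (v : V) (i : Fin d) (w : List (Fin d)) :
    N.walk v (i :: w) = N.walk (N.atPort v i) w := rfl

theorem walk_append (N : Network V) (v : V) (w w' : List (Fin d)) :
    N.walk v (w ++ w') = N.walk (N.walk v w) w' := by
  simp [walk]

theorem atPort_of_le (N : Network V) {v : V} {i : ℕ} (h : (N.ports v).length ≤ i) :
    N.atPort v i = v := List.getD_eq_default _ _ h

theorem exists_atPort_eq (N : Network V) (hd : ∀ v, (N.ports v).length ≤ d) {v u : V}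
    (h : N.graph.Adj v u) : ∃ i : Fin d, N.atPort v i = u := by
  obtain ⟨i, hi, rfl⟩ := List.mem_iff_getElem.1 ((N.mem_ports v u).2 h)
  exact ⟨⟨i, hi.trans_le (hd v)⟩, List.getD_eq_getElem _ _ hi⟩

theorem length_ports_le (N : Network V) (hN : DegreeAtMost d V N.graph) (v : V) :
    (N.ports v).length ≤ d := by
  classical
  have h : N.graph.neighborSet v = ((N.ports v).toFinset : Set V) := by
    ext u; simp [N.mem_ports]
  have := hN v
  rw [h, Set.encard_coe_eq_coe_finsetCard, List.toFinset_card_of_nodup (N.ports_nodup v)] at this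
  exact_mod_cast this

/-- Links are bidirectional, and a skipped port is undone by skipping it again, so reversal
preserves the length. -/
theorem exists_walk_reverse (N : Network V) (hd : ∀ v, (N.ports v).length ≤ d) (v : V)
    (w : List (Fin d)) : ∃ w' : List (Fin d), w'.length = w.length ∧
      N.walk (N.walk v w) w' = v := by
  induction w generalizing v with
  | nil => exact ⟨[], rfl, rfl⟩
  | cons i w ih =>
    obtain ⟨w', hl, hw⟩ := ih (N.atPort v i)
    obtain ⟨j, hj⟩ : ∃ j : Fin d, N.atPort (N.atPort v i) j = v := by
      rcases lt_or_ge (i : ℕ) (N.ports v).length with h | h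
      · exact N.exists_atPort_eq hd (N.atPort_adj h).symm
      · exact ⟨i, by rw [N.atPort_of_le h, N.atPort_of_le h]⟩
    exact ⟨w' ++ [j], by simp [hl], by
      rw [walk_append, walk_cons N v, hw, walk_cons, hj, walk_nil]⟩

/-- The pairs of walks of length at most `r` from `v` that lead to the same node. -/
def pattern (N : Network V) (d r : ℕ) (v : V) : Set (List (Fin d) × List (Fin d)) :=
  {p | p.1.length ≤ r ∧ p.2.length ≤ r ∧ N.walk v p.1 = N.walk v p.2}

/-- Up to the threshold `T`, the two networks have equally many nodes of each kind, where the
kind of a node depends on its pattern of radius `R`. -/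
def CountsAgree (d R T : ℕ) (N : Network V) (N' : Network V') : Prop :=
  ∀ Q : Set (List (Fin d) × List (Fin d)) → Prop,
    min T {v | Q (N.pattern d R v)}.ncard = min T {v | Q (N'.pattern d R v)}.ncard

theorem CountsAgree.symm {R T : ℕ} {N : Network V} {N' : Network V'}
    (h : CountsAgree d R T N N') : CountsAgree d R T N' N := fun Q => (h Q).symm

theorem pattern_inter (N : Network V) {r R : ℕ} (hr : r ≤ R) (v : V) :
    N.pattern d r v = N.pattern d R v ∩ {p | p.1.length ≤ r ∧ p.2.length ≤ r} := by
  ext p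
  simp only [pattern, Set.mem_inter_iff, Set.mem_ofPred_eq]
  constructor
  · rintro ⟨h1, h2, h3⟩
    exact ⟨⟨h1.trans hr, h2.trans hr, h3⟩, h1, h2⟩
  · rintro ⟨⟨-, -, h3⟩, h1, h2⟩
    exact ⟨h1, h2, h3⟩

/-- The smaller pattern is a function of the larger one. Because `CountsAgree` quantifies over all
properties of patterns, coarsening is just a special choice of `Q`. -/
theorem CountsAgree.mono {r R t T : ℕ} {N : Network V} {N' : Network V'}
    (h : CountsAgree d R T N N') (hr : r ≤ R) (ht : t ≤ T) : CountsAgree d r t N N' := by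
  intro Q
  have := h fun A => Q (A ∩ {p | p.1.length ≤ r ∧ p.2.length ≤ r})
  simp only [← pattern_inter _ hr] at this
  omega

/-! ### Back-and-forth equivalence of tuples -/

/-- The same walks of length at most `r` from the two tuples meet. -/
def TupleEquiv {ι : Type} (d r : ℕ) (N : Network V) (N' : Network V') (a : ι → V) (b : ι → V') :
    Prop :=
  ∀ (i j : ι) (w w' : List (Fin d)), w.length ≤ r → w'.length ≤ r →
    (N.walk (a i) w = N.walk (a j) w' ↔ N'.walk (b i) w = N'.walk (b j) w')

section TupleEquiv

variable {ι κ : Type} {N : Network V} {N' : Network V'} {a : ι → V} {b : ι → V'} {r R : ℕ}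

theorem TupleEquiv.symm (h : TupleEquiv d r N N' a b) : TupleEquiv d r N' N b a :=
  fun i j w w' hw hw' => (h i j w w' hw hw').symm

theorem TupleEquiv.mono (h : TupleEquiv d R N N' a b) (hr : r ≤ R) : TupleEquiv d r N N' a b :=
  fun i j w w' hw hw' => h i j w w' (hw.trans hr) (hw'.trans hr)

/-- The radius `3 * r` pays for `2 * r` steps to the new nodes and `r` steps beyond them. -/
theorem TupleEquiv.walk (h : TupleEquiv d (3 * r) N N' a b) (f : κ → ι) (u : κ → List (Fin d))
    (hu : ∀ m, (u m).length ≤ 2 * r) :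
    TupleEquiv d r N N' (fun m => N.walk (a (f m)) (u m)) (fun m => N'.walk (b (f m)) (u m)) := by
  intro i j w w' hw hw'
  simp only [← walk_append]
  have := hu i
  have := hu j
  exact h _ _ _ _ (by rw [List.length_append]; omega) (by rw [List.length_append]; omega)

theorem TupleEquiv.pattern_eq (h : TupleEquiv d r N N' a b) (i : ι) :
    N.pattern d r (a i) = N'.pattern d r (b i) := by
  ext ⟨w, w'⟩
  simp only [pattern, Set.mem_ofPred_eq]
  exact and_congr_right fun hw => and_congr_right fun hw' => h i i w w' hw hw'

/-- On `I`, the map `g` factors through `f`. -/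
theorem ncard_image_le_of_eq {α β γ : Type*} {I : Set α} (hI : I.Finite) {f : α → β} {g : α → γ}
    (h : ∀ x ∈ I, ∀ y ∈ I, f x = f y → g x = g y) : (g '' I).ncard ≤ (f '' I).ncard := by
  classical
  rcases I.eq_empty_or_nonempty with rfl | ⟨x₀, hx₀⟩
  · simp
  · let k : β → γ := fun y => if hy : ∃ x ∈ I, f x = y then g hy.choose else g x₀
    have hk : g '' I = k '' (f '' I) := by
      rw [Set.image_image]
      refine Set.image_congr fun x hx => ?_
      have hy : ∃ x' ∈ I, f x' = f x := ⟨x, hx, rfl⟩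
      simp only [k, dif_pos hy]
      exact h x hx _ hy.choose_spec.1 hy.choose_spec.2.symm
    rw [hk]
    exact Set.ncard_image_le (hI.image f)

/-- The extension property of the back-and-forth game. -/
theorem TupleEquiv.exists_snoc {k T : ℕ} {a : Fin k → V} {b : Fin k → V'}
    (hd : ∀ v, (N.ports v).length ≤ d) (hd' : ∀ v, (N'.ports v).length ≤ d)
    (h : TupleEquiv d (3 * r) N N' a b) (hc : CountsAgree d r T N N')
    (hT : ((Set.univ : Set (Fin k)) ×ˢ {u : List (Fin d) | u.length ≤ 2 * r}).ncard < T)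
    (x : V) : ∃ y : V', TupleEquiv d r N N' (Fin.snoc a x : Fin (k + 1) → V)
      (Fin.snoc b y : Fin (k + 1) → V') := by
  -- If `x` is near the tuple, the answer is the end of the same walk on the other side.
  by_cases hx : ∃ (i : Fin k) (u : List (Fin d)), u.length ≤ 2 * r ∧ N.walk (a i) u = x
  · obtain ⟨i, u, hu, rfl⟩ := hx
    refine ⟨N'.walk (b i) u, ?_⟩
    have := h.walk (Fin.snoc id i : Fin (k + 1) → Fin k)
      (Fin.snoc (fun _ => []) u : Fin (k + 1) → List (Fin d)) (by
        intro m
        refine Fin.lastCases ?_ (fun j => ?_) m <;> simp [hu])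
    convert this using 1 <;>
    · ext m
      refine Fin.lastCases ?_ (fun j => ?_) m <;> simp
  · push Not at hx
    -- If every node of `N'` with the pattern of `x` were near `b`, there would be fewer than `T` of
    -- them and no more than such nodes near `a`. But `N` has at least one more, namely `x`,
    -- contradicting the agreement of counts.
    obtain ⟨y, hy, hyb⟩ : ∃ y : V', N'.pattern d r y = N.pattern d r x ∧
        ∀ (i : Fin k) (u : List (Fin d)), u.length ≤ 2 * r → N'.walk (b i) u ≠ y := by
      by_contra! hne
      let U : Set (Fin k × List (Fin d)) := Set.univ ×ˢ {u : List (Fin d) | u.length ≤ 2 * r}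
      have hU : U.Finite := Set.finite_univ.prod (List.finite_length_le _ _)
      let I : Set (Fin k × List (Fin d)) :=
        {p ∈ U | N.pattern d r (N.walk (a p.1) p.2) = N.pattern d r x}
      have hI : I.Finite := hU.subset fun p hp => hp.1
      have hpat : ∀ p ∈ U, N.pattern d r (N.walk (a p.1) p.2) =
          N'.pattern d r (N'.walk (b p.1) p.2) := fun p hp =>
        (h.walk (fun _ : Unit => p.1) (fun _ => p.2) fun _ => hp.2).pattern_eq ()
      have h1 : ((fun p : Fin k × List (Fin d) => N'.walk (b p.1) p.2) '' I).ncard ≤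
          ((fun p : Fin k × List (Fin d) => N.walk (a p.1) p.2) '' I).ncard := by
        refine ncard_image_le_of_eq hI fun p hp q hq hpq => ?_
        have h2 : ∀ p ∈ U, p.2.length ≤ 3 * r := fun p hp => hp.2.trans (by omega)
        exact (h p.1 q.1 p.2 q.2 (h2 p hp.1) (h2 q hq.1)).1 hpq
      have h2 : ((fun p : Fin k × List (Fin d) => N.walk (a p.1) p.2) '' I).ncard <
          {v | N.pattern d r v = N.pattern d r x}.ncard := by
        refine Set.ncard_lt_ncard ⟨?_, ?_⟩ (Set.toFinite _)
        · rintro _ ⟨p, hp, rfl⟩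
          exact hp.2
        · intro hsub
          obtain ⟨p, hp, hpx⟩ := hsub (show N.pattern d r x = N.pattern d r x from rfl)
          exact hx p.1 p.2 hp.1.2 hpx
      have h3 : {v | N'.pattern d r v = N.pattern d r x}.ncard ≤
          ((fun p : Fin k × List (Fin d) => N'.walk (b p.1) p.2) '' I).ncard := by
        refine Set.ncard_le_ncard ?_ (hI.image _)
        intro y hy
        obtain ⟨i, u, hu, rfl⟩ := hne y hy
        have hiu : (i, u) ∈ U := ⟨Set.mem_univ _, hu⟩
        exact ⟨(i, u), ⟨hiu, (hpat _ hiu).trans hy⟩, rfl⟩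
      have h4 : ((fun p : Fin k × List (Fin d) => N'.walk (b p.1) p.2) '' I).ncard ≤ U.ncard :=
        (Set.ncard_image_le hI).trans (Set.ncard_le_ncard (fun p hp => hp.1) hU)
      have h5 := hc fun A => A = N.pattern d r x
      have h6 : U.ncard < T := hT
      omega
    refine ⟨y, ?_⟩
    -- If the walks met, reversing the second would give a walk of length at most `2 * r` from `a i`
    -- to `x`.
    have hfar : ∀ (i : Fin k) (w w' : List (Fin d)), w.length ≤ r → w'.length ≤ r →
        N.walk (a i) w ≠ N.walk x w' := by
      intro i w w' hw hw' heq
      obtain ⟨w'', hl, hw''⟩ := N.exists_walk_reverse hd x w'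
      refine hx i (w ++ w'') (by rw [List.length_append]; omega) ?_
      rw [walk_append, heq, hw'']
    have hfar' : ∀ (i : Fin k) (w w' : List (Fin d)), w.length ≤ r → w'.length ≤ r →
        N'.walk (b i) w ≠ N'.walk y w' := by
      intro i w w' hw hw' heq
      obtain ⟨w'', hl, hw''⟩ := N'.exists_walk_reverse hd' y w'
      refine hyb i (w ++ w'') (by rw [List.length_append]; omega) ?_
      rw [walk_append, heq, hw'']
    intro i j w w' hw hw'
    refine Fin.lastCases ?_ (fun i => ?_) i <;> refine Fin.lastCases ?_ (fun j => ?_) j <;>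
      simp only [Fin.snoc_last, Fin.snoc_castSucc]
    · have := Set.ext_iff.1 hy (w, w')
      simp only [pattern, Set.mem_ofPred_eq, hw, hw', true_and] at this
      exact this.symm
    · exact iff_of_false (hfar j w' w hw' hw).symm (hfar' j w' w hw' hw).symm
    · exact iff_of_false (hfar i w w' hw hw') (hfar' i w w' hw hw')
    · exact h i j w w' (by omega) (by omega)

end TupleEquiv

/-- Hanf's theorem for networks of bounded degree: the truth value of a formula at a tuple depends
only on the pattern of the tuple and on the numbers of nodes with given patterns, up to a
threshold. -/
theorem exists_realize_iff (d : ℕ) {k : ℕ} (φ : Language.graph.BoundedFormula Empty k) :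
    ∃ R T : ℕ, ∀ (V V' : Type) [Fintype V] [Fintype V'] (N : Network V) (N' : Network V'),
      (∀ v, (N.ports v).length ≤ d) → (∀ v, (N'.ports v).length ≤ d) →
      CountsAgree d R T N N' → ∀ (a : Fin k → V) (b : Fin k → V'), TupleEquiv d R N N' a b →
      (@Language.BoundedFormula.Realize Language.graph V N.graph.structure _ _ φ default a ↔
        @Language.BoundedFormula.Realize Language.graph V' N'.graph.structure _ _ φ default b) := by
  induction φ with
  | falsum => exact ⟨0, 0, fun V V' _ _ N N' _ _ _ a b _ => Iff.rfl⟩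
  | equal t₁ t₂ =>
    refine ⟨0, 0, fun V V' _ _ N N' _ _ _ a b h => ?_⟩
    let := N.graph.structure
    let := N'.graph.structure
    rcases t₁ with (⟨⟨⟩⟩ | i) | ⟨f, _⟩
    · rcases t₂ with (⟨⟨⟩⟩ | j) | ⟨f, _⟩
      · exact h i j [] [] le_rfl le_rfl
      · exact isEmptyElim f
    · exact isEmptyElim f
  | rel S ts =>
    refine ⟨1, 0, fun V V' _ _ N N' hd hd' _ a b h => ?_⟩
    let := N.graph.structure
    let := N'.graph.structure
    cases S
    have hvar : ∀ m, ∃ i, ts m = Language.Term.var (Sum.inr i) := by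
      intro m
      rcases ts m with (⟨⟨⟩⟩ | i) | ⟨f, _⟩
      · exact ⟨i, rfl⟩
      · exact isEmptyElim f
    obtain ⟨i, hi⟩ := hvar 0
    obtain ⟨j, hj⟩ := hvar 1
    -- A missing port leads back to `x`, so distinctness has to be required separately.
    have hadj : ∀ {W : Type} [Fintype W] (M : Network W), (∀ v, (M.ports v).length ≤ d) →
        ∀ x y, M.graph.Adj x y ↔ (∃ m : Fin d, M.walk x [m] = M.walk y ([] : List (Fin d))) ∧
          ¬ M.walk x ([] : List (Fin d)) = M.walk y ([] : List (Fin d)) := by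
      intro W _ M hM x y
      constructor
      · intro hxy
        exact ⟨M.exists_atPort_eq hM hxy, hxy.ne⟩
      · rintro ⟨⟨m, hm⟩, hne⟩
        simp only [walk_cons, walk_nil] at hm hne
        rcases lt_or_ge (m : ℕ) (M.ports x).length with hl | hl
        · rw [← hm]; exact M.atPort_adj hl
        · rw [M.atPort_of_le hl] at hm; exact absurd hm hne
    change N.graph.Adj ((ts 0).realize (Sum.elim default a)) ((ts 1).realize (Sum.elim default a)) ↔
      N'.graph.Adj ((ts 0).realize (Sum.elim default b)) ((ts 1).realize (Sum.elim default b))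
    rw [hi, hj]
    simp only [Language.Term.realize_var, Sum.elim_inr]
    rw [hadj N hd, hadj N' hd']
    refine and_congr (exists_congr fun m => ?_) (not_congr ?_)
    · exact h i j [m] [] le_rfl (Nat.zero_le _)
    · exact h i j [] [] (Nat.zero_le _) (Nat.zero_le _)
  | imp φ ψ ihφ ihψ =>
    obtain ⟨R₁, T₁, h₁⟩ := ihφ
    obtain ⟨R₂, T₂, h₂⟩ := ihψ
    refine ⟨max R₁ R₂, max T₁ T₂, fun V V' _ _ N N' hd hd' hc a b h => ?_⟩
    simp only [Language.BoundedFormula.realize_imp]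
    rw [h₁ V V' N N' hd hd' (hc.mono (le_max_left _ _) (le_max_left _ _)) a b
        (h.mono (le_max_left _ _)),
      h₂ V V' N N' hd hd' (hc.mono (le_max_right _ _) (le_max_right _ _)) a b
        (h.mono (le_max_right _ _))]
  | @all k φ ih =>
    obtain ⟨R, T, h⟩ := ih
    -- `M` bounds the number of nodes within `2 * R` of a `k`-tuple, so the threshold `M + 1`
    -- guarantees a far answer.
    let M := ((Set.univ : Set (Fin k)) ×ˢ {u : List (Fin d) | u.length ≤ 2 * R}).ncard
    refine ⟨3 * R, max T (M + 1), fun V V' _ _ N N' hd hd' hc a b hab => ?_⟩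
    have hc1 : CountsAgree d R T N N' := hc.mono (by omega) (le_max_left _ _)
    have hc2 : CountsAgree d R (M + 1) N N' := hc.mono (by omega) (le_max_right _ _)
    simp only [Language.BoundedFormula.realize_all]
    constructor
    · intro hφ y
      obtain ⟨x, hx⟩ := hab.symm.exists_snoc hd' hd hc2.symm (Nat.lt_succ_self M) y
      exact (h V V' N N' hd hd' hc1 _ _ hx.symm).1 (hφ x)
    · intro hφ x
      obtain ⟨y, hy⟩ := hab.exists_snoc hd hd' hc2 (Nat.lt_succ_self M) x
      exact (h V V' N N' hd hd' hc1 _ _ hy).2 (hφ y)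

end Network

/-! ### Views: the neighbourhood of a node, coded as a natural number -/

/-- The list coded by a natural number. -/
def unview (K : ℕ) : List ℕ := (Encodable.decode K).getD []

/-- The identifier in a view. -/
def viewIdent (K : ℕ) : ℕ := (unview K).getD 0 0

/-- The view of the neighbour at port `i`; missing ports are skipped. -/
def viewStep (K i : ℕ) : ℕ := (unview K)[i + 1]?.getD K

/-- The view of the node reached along a list of port numbers. -/
def viewWalk {d : ℕ} (K : ℕ) (w : List (Fin d)) : ℕ := w.foldl (fun K i => viewStep K i) K

@[simp]
theorem unview_encode (l : List ℕ) : unview (Encodable.encode l) = l := by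
  simp [unview]

theorem primrec_unview : Primrec unview :=
  Primrec.option_getD.comp Primrec.decode (Primrec.const [])

theorem primrec_viewIdent : Primrec viewIdent :=
  (Primrec.list_getD 0).comp primrec_unview (Primrec.const 0)

theorem primrec_viewStep (i : ℕ) : Primrec fun K => viewStep K i :=
  Primrec.option_getD.comp (Primrec.list_getElem?.comp primrec_unview (Primrec.const (i + 1)))
    Primrec.id

theorem primrec_viewWalk {d : ℕ} (w : List (Fin d)) : Primrec fun K => viewWalk K w := by
  induction w with
  | nil => exact Primrec.id
  | cons i w ih => exact ih.comp (primrec_viewStep i)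

/-- Any function of finitely many primitive recursive Boolean tests is primitive recursive. -/
theorem primrec_of_tests {α β κ : Type*} [Primcodable α] [Primcodable β] [Finite κ]
    {p : κ → α → Bool} (hp : ∀ k, Primrec (p k)) (F : (κ → Bool) → β) :
    Primrec fun a => F fun k => p k a := by
  obtain ⟨n, ⟨e⟩⟩ := Finite.exists_equiv_fin κ
  have h1 : Primrec fun a => List.Vector.ofFn fun i => p (e.symm i) a :=
    Primrec.vector_ofFn fun i => hp (e.symm i)
  have h2 : Primrec fun v : List.Vector Bool n => F fun k => v.get (e k) := Primrec.dom_finite _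
  refine (h2.comp h1).of_eq fun a => ?_
  simp

namespace Network

variable {V : Type} [Fintype V]

/-- The view of `v` of radius `j`: its identifier and the views of radius `j - 1` of its
neighbours. -/
def view (N : Network V) : ℕ → V → ℕ
  | 0, v => Encodable.encode [N.ident v]
  | j + 1, v => Encodable.encode (N.ident v :: (N.ports v).map (N.view j))

theorem dist_lt_card (N : Network V) (v : V) : N.graph.dist N.root v < Fintype.card V := by
  obtain ⟨p, hp, hl⟩ := N.connected.exists_path_of_dist N.root v
  rw [← hl]
  exact hp.length_lt

theorem unview_view_zero (N : Network V) (v : V) : unview (N.view 0 v) = [N.ident v] := by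
  rw [view, unview_encode]

theorem unview_view_succ (N : Network V) (j : ℕ) (v : V) :
    unview (N.view (j + 1) v) = N.ident v :: (N.ports v).map (N.view j) := by
  rw [view, unview_encode]

theorem viewIdent_view (N : Network V) (j : ℕ) (v : V) : viewIdent (N.view j v) = N.ident v := by
  cases j <;> simp [viewIdent, unview_view_zero, unview_view_succ]

theorem viewStep_view_of_lt (N : Network V) (j : ℕ) {v : V} {i : ℕ}
    (hi : i < (N.ports v).length) : viewStep (N.view (j + 1) v) i = N.view j (N.atPort v i) := by
  simp [viewStep, unview_view_succ, atPort, hi]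

theorem viewStep_view_of_le (N : Network V) (j : ℕ) {v : V} {i : ℕ}
    (hi : (N.ports v).length ≤ i) : viewStep (N.view j v) i = N.view j (N.atPort v i) := by
  rw [N.atPort_of_le hi]
  cases j <;> simp [viewStep, unview_view_zero, unview_view_succ, hi]

theorem viewIdent_viewWalk_view (N : Network V) {d : ℕ} (w : List (Fin d)) {j : ℕ}
    (hw : w.length ≤ j) (v : V) : viewIdent (viewWalk (N.view j v) w) = N.ident (N.walk v w) := by
  induction w generalizing j v with
  | nil => exact N.viewIdent_view j v
  | cons i w ih =>
    obtain ⟨j, rfl⟩ : ∃ j', j = j' + 1 := ⟨j - 1, by simp at hw; omega⟩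
    simp only [List.length_cons] at hw
    change viewIdent (viewWalk (viewStep (N.view (j + 1) v) i) w) = N.ident (N.walk (N.atPort v i) w)
    rcases lt_or_ge (i : ℕ) (N.ports v).length with h | h
    · rw [N.viewStep_view_of_lt j h]; exact ih (by omega) _
    · rw [N.viewStep_view_of_le _ h]; exact ih (by omega) _

end Network

/-! ### Polynomial bounds for codes -/

/-- Since `n ≥ 2`, `n ^ p + 1 ≤ n ^ (p + 1)`. The added `1` in the conclusion is the successor in
the code of a nonempty list. -/
theorem pair_le_pow {n p a b : ℕ} (hn : 2 ≤ n) (ha : a ≤ n ^ p) (hb : b ≤ n ^ p) :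
    Nat.pair a b + 1 ≤ n ^ (2 * p + 2) := by
  have h1 : Nat.pair a b < (max a b + 1) ^ 2 := Nat.pair_lt_max_add_one_sq a b
  have h2 : max a b + 1 ≤ n ^ (p + 1) := by
    have : 1 ≤ n ^ p := Nat.one_le_pow _ _ (by omega)
    have : max a b ≤ n ^ p := max_le ha hb
    rw [pow_succ]
    nlinarith
  calc Nat.pair a b + 1 ≤ (max a b + 1) ^ 2 := h1
    _ ≤ (n ^ (p + 1)) ^ 2 := Nat.pow_le_pow_left h2 2
    _ = n ^ (2 * p + 2) := by rw [← pow_mul]; ring_nf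

theorem exists_encode_list_le (L p : ℕ) : ∃ q, ∀ n, 2 ≤ n → ∀ l : List ℕ, l.length ≤ L →
    (∀ x ∈ l, x ≤ n ^ p) → Encodable.encode l ≤ n ^ q := by
  induction L with
  | zero =>
    refine ⟨0, fun n _ l hl _ => ?_⟩
    obtain rfl := List.length_eq_zero_iff.1 (Nat.le_zero.1 hl)
    simp
  | succ L ih =>
    obtain ⟨q, hq⟩ := ih
    refine ⟨2 * max p q + 2, fun n hn l hl hx => ?_⟩
    cases l with
    | nil => simp
    | cons a l =>
      rw [Encodable.encode_list_cons]
      refine pair_le_pow hn ?_ ?_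
      · exact (hx a (by simp)).trans (Nat.pow_le_pow_right (by omega) (le_max_left _ _))
      · refine (hq n hn l (by simpa using hl) fun x h => hx x (by simp [h])).trans ?_
        exact Nat.pow_le_pow_right (by omega) (le_max_right _ _)

/-- A view is a list of at most `d + 1` numbers, nested to depth at most `R`, so the exponent
depends only on `d` and `R`. -/
theorem Network.exists_view_le (d R : ℕ) : ∃ q, ∀ (V : Type) [Fintype V] (N : Network V),
    (∀ v, (N.ports v).length ≤ d) → 2 ≤ Fintype.card V → ∀ j ≤ R, ∀ v,
      N.view j v ≤ Fintype.card V ^ q := by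
  induction R with
  | zero =>
    obtain ⟨q, hq⟩ := exists_encode_list_le 1 1
    refine ⟨q, fun V _ N _ hn j hj v => ?_⟩
    obtain rfl := Nat.le_zero.1 hj
    exact hq _ hn _ le_rfl (by simpa using (N.ident_mem v).2)
  | succ R ih =>
    obtain ⟨p, hp⟩ := ih
    obtain ⟨q, hq⟩ := exists_encode_list_le (d + 1) (max 1 p)
    refine ⟨max p q, fun V _ N hd hn j hj v => ?_⟩
    rcases Nat.lt_or_ge R j with hj' | hj'
    · obtain rfl : j = R + 1 := by omega
      refine (hq _ hn _ ?_ ?_).trans (Nat.pow_le_pow_right (by omega) (le_max_right _ _))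
      · simpa using hd v
      · simp only [List.mem_cons, List.mem_map]
        rintro x (rfl | ⟨u, -, rfl⟩)
        · refine (N.ident_mem v).2.trans ?_
          calc Fintype.card V = Fintype.card V ^ 1 := (pow_one _).symm
            _ ≤ _ := Nat.pow_le_pow_right (by omega) (le_max_left _ _)
        · exact (hp V N hd hn R le_rfl u).trans
            (Nat.pow_le_pow_right (by omega) (le_max_right _ _))
    · exact (hp V N hd hn j hj' v).trans (Nat.pow_le_pow_right (by omega) (le_max_left _ _))

/-! ### Sums over the BFS tree -/

namespace Network

variable {V : Type} [Fintype V] [DecidableEq V] {S : Type} [AddCommMonoid S]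

/-- The children of `v` in the BFS tree, in the order of the ports. -/
def children (N : Network V) (v : V) : List V :=
  (N.ports v).filter fun u => decide (u ≠ N.root ∧ N.parent u = v)

theorem mem_children (N : Network V) {v u : V} :
    u ∈ N.children v ↔ u ≠ N.root ∧ N.parent u = v := by
  simp only [children, List.mem_filter, decide_eq_true_eq, and_iff_right_iff_imp, N.mem_ports]
  rintro ⟨h, rfl⟩
  exact (N.parent_adj u h).symm

theorem dist_child (N : Network V) {v u : V} (h : u ∈ N.children v) :
    N.graph.dist N.root u = N.graph.dist N.root v + 1 := by
  obtain ⟨h1, rfl⟩ := N.mem_children.1 h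
  exact N.parent_dist u h1

/-- The sum of `s` over the first `k` levels of the subtree at `v`. -/
def levelSum (N : Network V) (s : V → S) : ℕ → V → S
  | 0, _ => 0
  | k + 1, v => s v + ((N.children v).map (N.levelSum s k)).sum

/-- The sum of `s` over the subtree at `v`. -/
noncomputable def subtreeSum (N : Network V) (s : V → S) (v : V) : S :=
  N.levelSum s (Fintype.card V - N.graph.dist N.root v) v

/-- The truncation level `card V - dist` is positive everywhere and drops by exactly one from a node
to its child. -/
theorem subtreeSum_eq (N : Network V) (s : V → S) (v : V) :
    N.subtreeSum s v = s v + ((N.children v).map (N.subtreeSum s)).sum := by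
  have h := N.dist_lt_card v
  obtain ⟨k, hk⟩ : ∃ k, Fintype.card V - N.graph.dist N.root v = k + 1 :=
    ⟨Fintype.card V - N.graph.dist N.root v - 1, by omega⟩
  rw [subtreeSum, hk, levelSum]
  congr 2
  refine List.map_congr_left fun u hu => ?_
  have := N.dist_child hu
  rw [subtreeSum, show Fintype.card V - N.graph.dist N.root u = k by omega]

/-- Grouping layer `i + 1` by parents turns the sums over children into one sum over that layer. -/
theorem sum_levelSum (N : Network V) (s : V → S) (k i : ℕ) :
    ∑ v with N.graph.dist N.root v = i, N.levelSum s k v =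
      ∑ v with i ≤ N.graph.dist N.root v ∧ N.graph.dist N.root v < i + k, s v := by
  induction k generalizing i with
  | zero =>
    simp only [levelSum, Finset.sum_const_zero]
    refine (Finset.sum_eq_zero fun v hv => ?_).symm
    have := (Finset.mem_filter.1 hv).2
    omega
  | succ k ih =>
    have h1 : ∀ v ∈ Finset.univ.filter (fun v => N.graph.dist N.root v = i),
        ((N.children v).map (N.levelSum s k)).sum =
        ∑ u ∈ (Finset.univ.filter fun u => N.graph.dist N.root u = i + 1) with N.parent u = v,
          N.levelSum s k u := by
      intro v hv
      have hnd : (N.children v).Nodup := (N.ports_nodup v).filter _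
      rw [← List.sum_toFinset _ hnd]
      refine Finset.sum_congr ?_ fun _ _ => rfl
      ext u
      have hv' := (Finset.mem_filter.1 hv).2
      rw [List.mem_toFinset, Finset.mem_filter, Finset.mem_filter]
      constructor
      · intro hu
        exact ⟨⟨Finset.mem_univ _, by rw [N.dist_child hu, hv']⟩, (N.mem_children.1 hu).2⟩
      · rintro ⟨⟨-, hu⟩, hp⟩
        refine N.mem_children.2 ⟨?_, hp⟩
        rintro rfl
        simp at hu
    simp only [levelSum]
    rw [Finset.sum_add_distrib, Finset.sum_congr rfl h1, Finset.sum_fiberwise_of_maps_to, ih]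
    · rw [← Finset.sum_union]
      · refine Finset.sum_congr ?_ fun _ _ => rfl
        ext v
        simp only [Finset.mem_union, Finset.mem_filter, Finset.mem_univ, true_and]
        omega
      · rw [Finset.disjoint_filter]
        intro v _ h1 h2
        omega
    · intro u hu
      have hu' := (Finset.mem_filter.1 hu).2
      have hr : u ≠ N.root := by rintro rfl; simp at hu'
      have := N.parent_dist u hr
      exact Finset.mem_filter.2 ⟨Finset.mem_univ _, by omega⟩

theorem subtreeSum_root (N : Network V) (s : V → S) : N.subtreeSum s N.root = ∑ v, s v := by
  have h := N.sum_levelSum s (Fintype.card V) 0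
  have h1 : (Finset.univ.filter fun v => N.graph.dist N.root v = 0) = {N.root} := by
    ext v
    simp [N.connected.dist_eq_zero_iff, eq_comm]
  have h2 : (Finset.univ.filter fun v => 0 ≤ N.graph.dist N.root v ∧
      N.graph.dist N.root v < 0 + Fintype.card V) = Finset.univ := by
    ext v
    simp [N.dist_lt_card v]
  rw [h1, h2, Finset.sum_singleton] at h
  rw [← h]
  simp [subtreeSum]

end Network

/-! ### Aggregation of node types over the network -/

instance : Finite PortStatus := Finite.of_equiv _ PortStatus.equivFin.symm

/-- Words of length at most `R` over `d` port numbers. -/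
abbrev Word (d R : ℕ) : Type := {w : List (Fin d) // w.length ≤ R}

instance (d R : ℕ) : Finite (Word d R) := (List.finite_length_le (Fin d) R).to_subtype

/-- The coincidences between walks, as a Boolean matrix. -/
abbrev NodeType (d R : ℕ) : Type := Word d R × Word d R → Bool

/-- Whether a port leads to a child. -/
def isChild : Option PortStatus → Bool
  | some .child => true
  | _ => false

/-- The ports that lead to a child. -/
def childPorts (l : LocalInput) : List ℕ :=
  (List.range l.2.2.length).filter fun i => isChild l.2.2[i]?

theorem primrec_childPorts : Primrec childPorts := by
  have hs : Primrec fun l : LocalInput => l.2.2 := Primrec.snd.comp Primrec.snd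
  have h1 : Primrec fun a : ℕ × LocalInput => isChild a.2.2.2[a.1]? :=
    (Primrec.dom_finite isChild).comp
      (Primrec.list_getElem?.comp (hs.comp Primrec.snd) Primrec.fst)
  have h2 : PrimrecRel fun (i : ℕ) (l : LocalInput) => isChild l.2.2[i]? = true :=
    PrimrecRel.comp (R := Eq) Primrec.eq h1 (Primrec.const true)
  have h3 : Primrec fun l : LocalInput => List.range l.2.2.length :=
    Primrec.list_range.comp (Primrec.list_length.comp hs)
  refine (Primrec₂.comp h2.listFilter h3 Primrec.id).of_eq fun l => ?_
  simp [childPorts]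

/-- The node type that can be read off a view. -/
def viewType {d R : ℕ} (K : ℕ) : NodeType d R :=
  fun p => decide (viewIdent (viewWalk K p.1.1) = viewIdent (viewWalk K p.2.1))

/-- A node type is a finite table of identifier comparisons, so `s` may be arbitrary. -/
theorem primrec_comp_viewType {d R : ℕ} {S : Type} [Primcodable S] (s : NodeType d R → S) :
    Primrec fun K => s (viewType K) := by
  refine primrec_of_tests (p := fun (p : Word d R × Word d R) (K : ℕ) =>
    decide (viewIdent (viewWalk K p.1.1) = viewIdent (viewWalk K p.2.1))) (fun p => ?_) s
  have h : PrimrecPred fun K : ℕ =>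
      viewIdent (viewWalk K p.1.1) = viewIdent (viewWalk K p.2.1) :=
    PrimrecRel.comp (R := Eq) Primrec.eq (primrec_viewIdent.comp (primrec_viewWalk _))
      (primrec_viewIdent.comp (primrec_viewWalk _))
  exact h.decide

section Aggregate

variable {d R : ℕ} {S : Type} [AddCommMonoid S] [Primcodable S]

/-- The sum of a list of codes of elements of `S`. -/
def addCodes (a : S) (ms : List ℕ) : S :=
  ms.foldl (fun b m => b + (Encodable.decode m).getD 0) a

theorem addCodes_map_encode {α : Type*} (a : S) (l : List α) (f : α → S) :
    addCodes a (l.map fun x => Encodable.encode (f x)) = a + (l.map f).sum := by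
  induction l generalizing a with
  | nil => simp [addCodes]
  | cons x l ih =>
    have := ih (a + f x)
    simp only [addCodes, List.map_cons, List.foldl_cons, Encodable.encodek, Option.getD_some,
      List.sum_cons] at this ⊢
    rw [this, add_assoc]

variable [Finite S]

theorem primrec_addCodes : Primrec₂ (addCodes : S → List ℕ → S) := by
  have hadd : Primrec fun p : S × S => p.1 + p.2 := Primrec.dom_finite _
  have hdec : Primrec fun m : ℕ => ((Encodable.decode m : Option S)).getD 0 :=
    Primrec.option_getD.comp Primrec.decode (Primrec.const 0)
  have h : Primrec₂ fun (_ : S × List ℕ) (p : S × ℕ) => p.1 + (Encodable.decode p.2).getD 0 :=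
    hadd.comp (Primrec.pair (Primrec.fst.comp Primrec.snd)
      (hdec.comp (Primrec.snd.comp Primrec.snd)))
  exact Primrec.list_foldl Primrec.snd Primrec.fst h

namespace DataflowProgram

/-- The tags and ports on which the payload for the tag `j` depends. -/
def aggregateNeed (R j : ℕ) (l : LocalInput) : List (ℕ × ℕ) :=
  if j = 0 then []
  else if j ≤ R then (List.range l.2.2.length).map fun i => (i, j - 1)
  else ((List.range l.2.2.length).map fun i => (i, R)) ++ (childPorts l).map fun i => (i, R + 1)

/-- The payload is the view of radius `j` if `j ≤ R`, and a sum over a subtree if `j = R + 1`. -/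
def aggregateOut (s : NodeType d R → S) (j : ℕ) (l : LocalInput) (ms : List ℕ) : ℕ :=
  if j ≤ R then Encodable.encode (l.1 :: ms)
  else Encodable.encode (addCodes
    (s (viewType (Encodable.encode (l.1 :: ms.take l.2.2.length)))) (ms.drop l.2.2.length))

/-- The program by which the requesting node learns the sum of `s` over all node types. First the
nodes broadcast their views of radius `0, …, R`; then sums over subtrees are passed to the
requesting node. -/
def aggregate (s : NodeType d R → S) (accept : S → Bool) : DataflowProgram where
  last := R + 1
  need := aggregateNeed R
  out := aggregateOut s
  final m := ((Encodable.decode m).map accept).getD false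
  primrec_need j := by
    have hr : Primrec fun l : LocalInput => List.range l.2.2.length :=
      Primrec.list_range.comp primrec_degree
    have hp (b : ℕ) : Primrec₂ fun (_ : LocalInput) (i : ℕ) => (i, b) :=
      Primrec.pair Primrec.snd (Primrec.const b)
    by_cases h0 : j = 0
    · exact (Primrec.const []).of_eq fun l => by simp [aggregateNeed, h0]
    by_cases hj : j ≤ R
    · exact (Primrec.list_map hr (hp (j - 1))).of_eq fun l => by simp [aggregateNeed, h0, hj]
    · exact (Primrec.list_append.comp (Primrec.list_map hr (hp R))
        (Primrec.list_map primrec_childPorts (hp (R + 1)))).of_eq fun l => by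
          simp [aggregateNeed, h0, hj]
  primrec_out j := by
    have hid : Primrec fun a : LocalInput × List ℕ => a.1.1 := Primrec.fst.comp Primrec.fst
    have hdeg : Primrec fun a : LocalInput × List ℕ => a.1.2.2.length :=
      primrec_degree.comp Primrec.fst
    by_cases hj : j ≤ R
    · exact (Primrec.encode.comp (Primrec.list_cons.comp hid Primrec.snd)).of_eq fun a => by
        simp only [aggregateOut, if_pos hj]
    · have h1 : Primrec fun a : LocalInput × List ℕ =>
          Encodable.encode (a.1.1 :: a.2.take a.1.2.2.length) :=
        Primrec.encode.comp (Primrec.list_cons.comp hid (Primrec.list_take.comp hdeg Primrec.snd))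
      have h2 : Primrec fun a : LocalInput × List ℕ => a.2.drop a.1.2.2.length :=
        Primrec.list_drop.comp hdeg Primrec.snd
      exact (Primrec.encode.comp (primrec_addCodes.comp ((primrec_comp_viewType s).comp h1)
        h2)).of_eq fun a => by simp only [aggregateOut, if_neg hj]
  primrec_final :=
    Primrec.option_getD.comp
      (Primrec.option_map Primrec.decode ((Primrec.dom_finite accept).comp Primrec.snd))
      (Primrec.const false)

end DataflowProgram

/-! ### Correctness of the aggregation program -/

namespace Network

variable {V : Type} [Fintype V]

/-- The coincidences between walks from `v`. -/
noncomputable def nodeType (N : Network V) (d R : ℕ) (v : V) : NodeType d R :=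
  open Classical in fun p => decide (N.walk v p.1.1 = N.walk v p.2.1)

theorem viewType_view (N : Network V) {j : ℕ} (hj : R ≤ j) (v : V) :
    (viewType (N.view j v) : NodeType d R) = N.nodeType d R v := by
  funext p
  rw [viewType, nodeType, N.viewIdent_viewWalk_view _ (p.1.2.trans hj),
    N.viewIdent_viewWalk_view _ (p.2.2.trans hj)]
  exact decide_eq_decide.2 N.ident_injective.eq_iff

theorem map_range_atPort (N : Network V) {α : Type*} (f : V → α) (v : V) :
    ((List.range (N.ports v).length).map fun i => f (N.atPort v i)) = (N.ports v).map f := by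
  refine List.ext_getElem (by simp) fun i h1 h2 => ?_
  have : i < (N.ports v).length := by simpa using h2
  simp [atPort, this]

variable [DecidableEq V]

theorem isChild_portStatus (N : Network V) {v u : V} :
    isChild (some (N.portStatus v u)) = decide (u ≠ N.root ∧ N.parent u = v) := by
  unfold portStatus
  by_cases h1 : v ≠ N.root ∧ N.parent v = u
  -- Two nodes cannot be each other's parents, as depths would increase both ways; hence testing for
  -- the parent first loses no child.
  · have h2 : ¬ (u ≠ N.root ∧ N.parent u = v) := by
      rintro ⟨h2, h3⟩
      have h4 := N.parent_dist v h1.1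
      have h5 := N.parent_dist u h2
      rw [h1.2] at h4
      rw [h3] at h5
      omega
    rw [if_pos h1, decide_eq_false h2]
    rfl
  · rw [if_neg h1]
    by_cases h2 : u ≠ N.root ∧ N.parent u = v
    · rw [if_pos h2, decide_eq_true h2]
      rfl
    · rw [if_neg h2, decide_eq_false h2]
      split_ifs <;> rfl

theorem map_childPorts (N : Network V) {α : Type*} (f : V → α) (v : V) :
    ((childPorts (N.localInput v)).map fun i => f (N.atPort v i)) = (N.children v).map f := by
  have h1 : childPorts (N.localInput v) = (List.range (N.ports v).length).filter
      ((fun u => decide (u ≠ N.root ∧ N.parent u = v)) ∘ N.atPort v) := by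
    rw [childPorts, N.localInput_degree]
    refine List.filter_congr fun i hi => ?_
    have hi' : i < (N.ports v).length := List.mem_range.1 hi
    rw [Function.comp_apply, ← N.isChild_portStatus]
    simp [localInput, atPort, hi']
  have h2 : N.ports v = (List.range (N.ports v).length).map (N.atPort v) := by
    have := (N.map_range_atPort id v).symm
    rwa [List.map_id] at this
  rw [h1, children]
  conv_rhs => rw [h2]
  rw [List.filter_map, List.map_map]
  rfl

/-- The sum of `s` over all node types of the network. -/
noncomputable def typeSum (N : Network V) (s : NodeType d R → S) : S :=
  ∑ v, s (N.nodeType d R v)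

/-- The payloads computed by the program `DataflowProgram.aggregate`. -/
noncomputable def aggregateVal (N : Network V) (s : NodeType d R → S) (v : V) (j : ℕ) : ℕ :=
  if j ≤ R then N.view j v
  else Encodable.encode (N.subtreeSum (fun v => s (N.nodeType d R v)) v)

theorem mem_childPorts_lt (N : Network V) {v : V} {i : ℕ}
    (hi : i ∈ childPorts (N.localInput v)) : i < (N.ports v).length := by
  have := (List.mem_filter.1 hi).1
  rwa [N.localInput_degree, List.mem_range] at this

theorem atPort_mem_children (N : Network V) {v : V} {i : ℕ}
    (hi : i ∈ childPorts (N.localInput v)) : N.atPort v i ∈ N.children v := by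
  have h := N.map_childPorts id v
  rw [List.map_id] at h
  rw [← h]
  exact List.mem_map_of_mem hi

theorem solves_aggregate (N : Network V) (s : NodeType d R → S) (accept : S → Bool) :
    (DataflowProgram.aggregate s accept).Solves N (N.aggregateVal s) where
  need_zero v := by simp [DataflowProgram.aggregate, DataflowProgram.aggregateNeed]
  need_mem v j hj k hk := by
    simp only [DataflowProgram.aggregate, DataflowProgram.aggregateNeed] at hj hk ⊢
    rw [N.localInput_degree] at hk
    split_ifs at hk with h0 hjR
    · simp at hk
    · obtain ⟨i, hi, rfl⟩ := List.mem_map.1 hk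
      exact ⟨List.mem_range.1 hi, by simp; omega⟩
    · rcases List.mem_append.1 hk with hk | hk
      · obtain ⟨i, hi, rfl⟩ := List.mem_map.1 hk
        exact ⟨List.mem_range.1 hi, by simp⟩
      · obtain ⟨i, hi, rfl⟩ := List.mem_map.1 hk
        exact ⟨N.mem_childPorts_lt hi, by simp⟩
  rank := by
    -- Views are ranked by radius. Sums come after all views and are ranked by height, deeper nodes
    -- first.
    refine ⟨fun v j => if j ≤ R then j else j + (Fintype.card V - N.graph.dist N.root v), ?_⟩
    intro v j hj k hk
    simp only [DataflowProgram.aggregate, DataflowProgram.aggregateNeed] at hj hk ⊢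
    split_ifs at hk with h0 hjR
    · simp at hk
    · obtain ⟨i, hi, rfl⟩ := List.mem_map.1 hk
      rw [if_pos hjR, if_pos (by simp; omega)]
      simp; omega
    · rw [if_neg hjR]
      rcases List.mem_append.1 hk with hk | hk
      · obtain ⟨i, hi, rfl⟩ := List.mem_map.1 hk
        rw [if_pos (by simp)]
        simp; omega
      · obtain ⟨i, hi, rfl⟩ := List.mem_map.1 hk
        have h1 := N.dist_child (N.atPort_mem_children hi)
        have h2 := N.dist_lt_card v
        rw [if_neg (by simp)]
        simp only
        omega
  val_eq v j hj := by
    simp only [DataflowProgram.aggregate, DataflowProgram.aggregateNeed,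
      DataflowProgram.aggregateOut] at hj ⊢
    rw [N.localInput_degree]
    have hid : (N.localInput v).1 = N.ident v := rfl
    rw [hid]
    by_cases hjR : j ≤ R
    · rw [if_pos hjR, aggregateVal, if_pos hjR]
      cases j with
      | zero => rfl
      | succ j =>
        rw [if_neg (Nat.succ_ne_zero j), if_pos hjR, view, List.map_map,
          ← N.map_range_atPort (N.view j)]
        congr 2
        refine List.map_congr_left fun i _ => ?_
        have : j ≤ R := by omega
        simp [aggregateVal, this]
    · obtain rfl : j = R + 1 := by omega
      rw [if_neg hjR, if_neg hjR, if_neg (Nat.succ_ne_zero R), aggregateVal, if_neg hjR,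
        subtreeSum_eq, List.map_append, List.map_map, List.map_map]
      have h1 : (List.range (N.ports v).length).map
          ((fun k : ℕ × ℕ => N.aggregateVal s (N.atPort v k.1) k.2) ∘ fun i => (i, R)) =
          (N.ports v).map (N.view R) := by
        rw [← N.map_range_atPort (N.view R)]
        refine List.map_congr_left fun i _ => ?_
        simp [aggregateVal]
      have h2 : (childPorts (N.localInput v)).map
          ((fun k : ℕ × ℕ => N.aggregateVal s (N.atPort v k.1) k.2) ∘ fun i => (i, R + 1)) =
          (N.children v).map
            fun u => Encodable.encode (N.subtreeSum (fun v => s (N.nodeType d R v)) u) := by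
        rw [← N.map_childPorts]
        refine List.map_congr_left fun i _ => ?_
        simp [aggregateVal]
      -- The first payloads, one per port, are the neighbours' views of radius `R` and form the
      -- node's own view of radius `R + 1`; the rest are the children's sums.
      rw [h1, h2, List.take_left' (by simp), List.drop_left' (by simp), addCodes_map_encode,
        ← viewType_view N (Nat.le_succ R) v]
      rfl

end Network

/-- A sentence can be frugally evaluated if its truth value on a network of bounded degree is a
function of a sum over all nodes, in a finite commutative monoid, of values depending only on the
types of the nodes. -/
theorem frugallyEvaluable_of_typeSum (φ : Language.graph.Sentence) (s : NodeType d R → S)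
    (accept : S → Bool)
    (h : ∀ (V : Type) [Fintype V] [DecidableEq V] (N : Network V), DegreeAtMost d V N.graph →
      (accept (N.typeSum s) = true ↔
        @Language.Sentence.Realize Language.graph V N.graph.structure φ)) :
    FrugallyEvaluable (DegreeAtMost d) φ := by
  obtain ⟨q, hq⟩ := Network.exists_view_le d R
  obtain ⟨B, hB⟩ : ∃ B, ∀ x : S, Encodable.encode x ≤ B := by
    obtain ⟨B, hB⟩ := (Set.finite_range (Encodable.encode : S → ℕ)).bddAbove
    exact ⟨B, fun x => hB ⟨x, rfl⟩⟩
  -- This exponent is that of `pair_le_pow` for `p = q + B + R + 1`, which dominates the tag, the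
  -- views and the codes of monoid elements.
  refine (DataflowProgram.aggregate s accept).frugallyEvaluable _ φ
    (2 * (q + B + R + 1) + 2) fun V _ _ N hN => ?_
  refine ⟨N.aggregateVal s, N.solves_aggregate s accept, ?_, fun hn v j hj => ?_⟩
  · rw [← h V N hN]
    have hv : N.aggregateVal s N.root (DataflowProgram.aggregate s accept).last =
        Encodable.encode (N.typeSum s) := by
      have hlast : ¬ (DataflowProgram.aggregate s accept).last ≤ R := Nat.not_succ_le_self R
      rw [Network.aggregateVal, if_neg hlast, Network.subtreeSum_root]
      rfl
    rw [hv]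
    simp [DataflowProgram.aggregate]
  · have hself : ∀ m b, m ≤ b → m ≤ Fintype.card V ^ b := fun m b hm =>
      hm.trans ((Nat.lt_pow_self (by omega)).le)
    have hj' : j ≤ R + 1 := hj
    refine (Nat.le_succ _).trans (pair_le_pow hn (hself _ _ (by omega)) ?_)
    unfold Network.aggregateVal
    split_ifs with hjR
    · exact (hq V N (N.length_ports_le hN) hn j hjR v).trans
        (Nat.pow_le_pow_right (by omega) (by omega))
    · exact hself _ _ ((hB _).trans (by omega))

end Aggregate

/-! ### Counting up to a threshold -/

/-- The congruence that identifies all numbers from `T` on. -/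
def thresholdCon (T : ℕ) : AddCon ℕ where
  r a b := min T a = min T b
  iseqv := ⟨fun _ => rfl, fun h => h.symm, fun h h' => h.trans h'⟩
  add' := by
    intro a b c e h h'
    change min T a = min T b at h
    change min T c = min T e at h'
    omega

instance (T : ℕ) : Finite (thresholdCon T).Quotient := by
  refine Finite.of_surjective (fun i : Fin (T + 1) => ((i : ℕ) : (thresholdCon T).Quotient)) ?_
  intro x
  induction x using AddCon.induction_on with
  | H n =>
    refine ⟨⟨min T n, by omega⟩, ?_⟩
    rw [AddCon.eq]
    change min T (min T n) = min T n
    omega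

/-- Counts, for each set of node types, whether a given type belongs to it. -/
noncomputable def countType (d R T : ℕ) (τ : NodeType d R) :
    Set (NodeType d R) → (thresholdCon T).Quotient :=
  open Classical in fun A => if τ ∈ A then ((1 : ℕ) : (thresholdCon T).Quotient) else 0

namespace Network

/-- The quotient map is additive, so the sum of indicators is the class of the cardinality. -/
theorem typeSum_countType {V : Type} [Fintype V] (N : Network V) (d R T : ℕ)
    (A : Set (NodeType d R)) : N.typeSum (countType d R T) A =
      (({v | N.nodeType d R v ∈ A}.ncard : ℕ) : (thresholdCon T).Quotient) := by
  classical
  have h : ∀ v, countType d R T (N.nodeType d R v) A =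
      AddCon.mk' (thresholdCon T) (if N.nodeType d R v ∈ A then 1 else 0) := by
    intro v
    unfold countType
    split_ifs <;> rfl
  rw [typeSum, Finset.sum_apply, Finset.sum_congr rfl fun v _ => h v, ← map_sum,
    ← Finset.card_filter, Set.ncard_eq_toFinset_card']
  simp only [Set.toFinset_ofPred]
  rfl

/-- A pattern is a function `g` of the node type, so a property of patterns is a set of types, that
is, one coordinate of the sum. -/
theorem countsAgree_of_typeSum_eq {V V' : Type} [Fintype V] [Fintype V'] {N : Network V}
    {N' : Network V'} {d R T : ℕ}
    (h : N.typeSum (countType d R T) = N'.typeSum (countType d R T)) :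
    CountsAgree d R T N N' := by
  intro Q
  let g : NodeType d R → Set (List (Fin d) × List (Fin d)) := fun τ =>
    {p | ∃ (h₁ : p.1.length ≤ R) (h₂ : p.2.length ≤ R), τ (⟨p.1, h₁⟩, ⟨p.2, h₂⟩) = true}
  have hg : ∀ {W : Type} [Fintype W] (M : Network W) (v : W),
      M.pattern d R v = g (M.nodeType d R v) := by
    intro W _ M v
    ext p
    simp only [pattern, g, nodeType, Set.mem_ofPred_eq, decide_eq_true_eq, exists_prop]
  have h1 := congrFun h {τ | Q (g τ)}
  rw [typeSum_countType, typeSum_countType, AddCon.eq] at h1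
  simp only [hg]
  exact h1

end Network

theorem mainTheorem1 (d : ℕ) (φ : FirstOrder.Language.graph.Sentence) :
    FrugallyEvaluable (DegreeAtMost d) φ := by
  classical
  obtain ⟨R, T, hRT⟩ := Network.exists_realize_iff d φ
  let S := Set (NodeType d R) → (thresholdCon T).Quotient
  obtain ⟨n, ⟨e⟩⟩ := Finite.exists_equiv_fin S
  let : Primcodable S := Primcodable.ofEquiv (Fin n) e
  -- The definition is not effective, but a function on the finite type `S` is a finite table. By
  -- `hRT`, all networks of degree at most `d` with the same sum agree on `φ`, so one witness
  -- suffices.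
  let accept : S → Bool := fun x => decide (∃ (V : Type) (_ : Fintype V) (N : Network V),
    DegreeAtMost d V N.graph ∧ N.typeSum (countType d R T) = x ∧
      @Language.Sentence.Realize Language.graph V N.graph.structure φ)
  refine frugallyEvaluable_of_typeSum φ (countType d R T) accept fun V _ _ N hN => ?_
  simp only [accept, decide_eq_true_eq]
  constructor
  · rintro ⟨V', _, N', hN', hsum, hφ⟩
    exact (hRT V' V N' N (N'.length_ports_le hN') (N.length_ports_le hN)
      (Network.countsAgree_of_typeSum_eq hsum) default default fun i => i.elim0).1 hφ
  · intro hφ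
    exact ⟨V, inferInstance, N, hN, rfl, hφ⟩
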